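/- Let $n\ge 1$ and let $R=\mathrm{GR}(4,n)=\mathbb Z_4[X]/(h)$ be the Galois ring, $h$ a monic polynomial of degree $n$ whose reduction modulo $2$ is irreducible. Let $T=\{x\in R: x^{2^n}=x\}$ be its Teichmüller system, write $\sqrt x=x^{2^{n-1}}$, and recall that $T$ with the multiplication of $R$ and $x\oplus y=x+y+2\sqrt{xy}$ is a finite field $\mathbb F_{2^n}$. Let $f:T\to T$ be pseudo-planar, i.e. $x\mapsto f(x\oplus\varepsilon)\oplus f(x)\oplus\varepsilon x$ is a permutation of $T$ for every $\varepsilon\in T\setminus\{0\}$, and suppose $f(0)=0$. Put $Z=2R$, $D_f=\{x+2\sqrt{f(x)}:x\in T\}$ and $$S_0=\{0\},\quad S_1=D_f\setminus\{0\},\quad S_2=-S_1,\quad S_3=Z\setminus\{0\};$$ let $S_4$ (resp. $S_5$) be the set of the remaining elements of $R$ that do (resp. do not) have the form $x+y$ with $x,y\in D_f$. For a character $\chi$ of $(R,+)$ and $S\subseteq R$ let $\chi(S)=\sum_{x\in S}\chi(x)$. Let $E_0$ consist of the principal character, and let $E_1,\dots,E_5$ be the sets of characters $\chi$ for which $\chi(S_1)$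 equals, in this order, $$-1,\ -1+b+b\mathbf i,\ -1+b-b\mathbf i,\ -1-b+b\mathbf i,\ -1-b-b\mathbf i\qquad (n \text{ odd},\ b=2^{(n-1)/2}),$$ $$-1,\ -1+2b,\ -1-2b,\ -1+2b\mathbf i,\ -1-2b\mathbf i\qquad (n\text{ even},\ b=2^{(n-2)/2}).$$ Then $\{S_i\}$ is a Schur ring over $R$: it partitions $R$, and the relations $R_i=\{(x,y):x-y\in S_i\}$ form an association scheme on $R$ (empty classes, which occur only for $n\le 2$, being left out). Its dual is $\{E_i\}$: the $E_i$ partition the character group, two characters $\chi,\psi$ lie in the same $E_i$ if and only if $\chi(S_k)=\psi(S_k)$ for all $k$, which is equivalent to $\chi(S_1)=\psi(S_1)$, and $\{E_i\}$ is a Schur ring over the character group. Moreover $E_1$ consists of the nonprincipal characters that are trivial on $Z$. If $n\ge 3$, then all $S_i$ are nonempty and $(R,\{R_i\}_{i=0}^5)$ is a $5$-class association scheme. Let $A_i$ be the adjacency matrix of $R_i$. The span of the $A_i$ has a basis $e_0,\dots,e_5$ of pairwise orthogonal idempotents such that $A_i=\sum_j P_{ji}e_j$ and $e_i=|R|^{-1}\sum_jQ_{ji}A_j$,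 where $P_{ji}=\chi(S_i)$ for all $\chi\in E_j$, and the first and second eigenmatrices $P,Q$ are as follows. For $n$ odd, $b=2^{(n-1)/2}$, $$P=\begin{bmatrix}1&2b^2-1&2b^2-1&2b^2-1&2b^4-3b^2+1&2b^4-3b^2+1\\1&-1&-1&2b^2-1&-b^2+1&-b^2+1\\1&-1+b+b\mathbf i&-1+b-b\mathbf i&-1&(1-b)(1-b\mathbf i)&(1-b)(1+b\mathbf i)\\1&-1+b-b\mathbf i&-1+b+b\mathbf i&-1&(1-b)(1+b\mathbf i)&(1-b)(1-b\mathbf i)\\1&-1-b+b\mathbf i&-1-b-b\mathbf i&-1&(1+b)(1-b\mathbf i)&(1+b)(1+b\mathbf i)\\1&-1-b-b\mathbf i&-1-b+b\mathbf i&-1&(1+b)(1+b\mathbf i)&(1+b)(1-b\mathbf i)\end{bmatrix},$$ $$Q=\begin{bmatrix}1&2b^2-1&\frac b2(2b^3+2b^2-b-1)&\frac b2(2b^3+2b^2-b-1)&\frac b2(2b^3-2b^2-b+1)&\frac b2(2b^3-2b^2-b+1)\\1&-1&\frac b2(b^2-1-(b^2+b)\mathbf i)&\frac b2(b^2-1+(b^2+b)\mathbf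 i)&\frac b2(1-b^2-(b^2-b)\mathbf i)&\frac b2(1-b^2+(b^2-b)\mathbf i)\\1&-1&\frac b2(b^2-1+(b^2+b)\mathbf i)&\frac b2(b^2-1-(b^2+b)\mathbf i)&\frac b2(1-b^2+(b^2-b)\mathbf i)&\frac b2(1-b^2-(b^2-b)\mathbf i)\\1&2b^2-1&-\frac b2(1+b)&-\frac b2(1+b)&\frac b2(1-b)&\frac b2(1-b)\\1&-1&-\frac b2(1+b\mathbf i)&\frac b2(-1+b\mathbf i)&\frac b2(1+b\mathbf i)&\frac b2(1-b\mathbf i)\\1&-1&\frac b2(-1+b\mathbf i)&-\frac b2(1+b\mathbf i)&\frac b2(1-b\mathbf i)&\frac{b(b^2+1)}{2(1-b\mathbf i)}\end{bmatrix}.$$ For $n$ even, $b=2^{(n-2)/2}$, $$P=\begin{bmatrix}1&4b^2-1&4b^2-1&4b^2-1&8b^4-10b^2+2&8b^4-2b^2\\1&-1&-1&4b^2-1&-2b^2+2&-2b^2\\1&2b-1&2b-1&-1&2b^2-4b+2&-2b^2\\1&-2b-1&-2b-1&-1&2b^2+4b+2&-2b^2\\1&-1+2b\mathbf i&-1-2b\mathbf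 i&-1&-2b^2+2&2b^2\\1&-1-2b\mathbf i&-1+2b\mathbf i&-1&-2b^2+2&2b^2\end{bmatrix},$$ $$Q=\begin{bmatrix}1&4b^2-1&b(4b^3-b+4b^2-1)&b(4b^3-4b^2-b+1)&b^2(4b^2-1)&b^2(4b^2-1)\\1&-1&b(b+2b^2-1)&-(2b^2-b-1)b&-b^2(1+2b\mathbf i)&b^2(-1+2b\mathbf i)\\1&-1&b(b+2b^2-1)&-(2b^2-b-1)b&b^2(-1+2b\mathbf i)&-b^2(1+2b\mathbf i)\\1&4b^2-1&-b(1+b)&-b(-1+b)&-b^2&-b^2\\1&-1&b(-1+b)&b(1+b)&-b^2&-b^2\\1&-1&-b(1+b)&-b(-1+b)&b^2&b^2\end{bmatrix}.$$ -/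

import Mathlib

open Polynomial

/-! ### The Galois ring of characteristic `4` with `4 ^ n` elements -/

/-- A monic basic irreducible polynomial of degree `n` over `ℤ/4`: its reduction modulo `2` is
irreducible over `𝔽₂`. -/
structure BasicIrreducible (n : ℕ) where
  poly : (ZMod 4)[X]
  monic : poly.Monic
  natDegree_eq : poly.natDegree = n
  irreducible_map : Irreducible (poly.map (ZMod.castHom (show 2 ∣ 4 by norm_num) (ZMod 2)))

/-- The Galois ring `GR(4, n) = (ℤ/4)[X] / (h)`, where `h` is a monic basic irreducible polynomial
of degree `n`. -/
abbrev GR4 {n : ℕ} (h : BasicIrreducible n) : Type := AdjoinRoot h.poly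

instance GR4.instFinite {n : ℕ} (h : BasicIrreducible n) : Finite (GR4 h) :=
  haveI := h.monic.finite_adjoinRoot
  Module.finite_of_finite (ZMod 4)

noncomputable instance GR4.instFintype {n : ℕ} (h : BasicIrreducible n) : Fintype (GR4 h) :=
  Fintype.ofFinite _

/-- In the Galois ring, `√x` stands for `x ^ (2 ^ (n - 1))`. -/
noncomputable def GR4.sqrt {n : ℕ} {h : BasicIrreducible n} (x : GR4 h) : GR4 h :=
  x ^ 2 ^ (n - 1)

/-- The Teichmüller system `T` of `GR(4, n)`: the solutions of `x ^ (2 ^ n) = x`, that is `0`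
together with the cyclic group of order `2 ^ n - 1` in the unit group. -/
@[ext]
structure Teich {n : ℕ} (h : BasicIrreducible n) where
  val : GR4 h
  pow_eq : val ^ 2 ^ n = val

namespace Teich

variable {n : ℕ} {h : BasicIrreducible n}

noncomputable instance : Zero (Teich h) := ⟨⟨0, by simp⟩⟩

noncomputable instance : Mul (Teich h) := ⟨fun x y => ⟨x.val * y.1, by rw [mul_pow, x.pow_eq, y.pow_eq]⟩⟩

theorem four_eq_zero (h : BasicIrreducible n) : (4 : GR4 h) = 0 := by
  have h4 : (4 : ZMod 4) = 0 := by decide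
  have := congrArg (algebraMap (ZMod 4) (GR4 h)) h4
  rwa [map_zero, map_ofNat] at this

theorem two_pow_frob {A : Type*} [CommRing A] (u v : A) (m : ℕ) :
    ∃ w, (u + v) ^ 2 ^ m = u ^ 2 ^ m + v ^ 2 ^ m + 2 * w := by
  induction m with
  | zero => exact ⟨0, by simp⟩
  | succ m ih =>
    obtain ⟨w, hw⟩ := ih
    refine ⟨u ^ 2 ^ m * v ^ 2 ^ m + 2 * w * (u ^ 2 ^ m + v ^ 2 ^ m) + 2 * w ^ 2, ?_⟩
    rw [pow_succ, pow_mul, pow_mul, pow_mul, hw]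
    ring

theorem add_closed (x y : Teich h) :
    (x.val + y.val + 2 * GR4.sqrt (x.val * y.val)) ^ 2 ^ n = x.val + y.val + 2 * GR4.sqrt (x.val * y.val) := by
  have hn : n ≠ 0 := by
    rintro rfl
    have h1 : h.poly = 1 := Polynomial.eq_one_of_monic_natDegree_zero h.monic h.natDegree_eq
    have := h.irreducible_map.not_isUnit
    simp [h1] at this
  obtain ⟨m, rfl⟩ := Nat.exists_eq_succ_of_ne_zero hn
  have hs : ∀ z : Teich h, (z.val ^ 2 ^ m) ^ 2 = z.val := fun z => by
    rw [← pow_mul, ← pow_succ]; exact z.pow_eq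
  have hr : ∀ z : Teich h, (z.val ^ 2 ^ m) ^ 2 ^ (m + 1) = z.val ^ 2 ^ m := fun z => by
    rw [← pow_mul, mul_comm, pow_mul, z.pow_eq]
  have hu : x.val + y.val + 2 * GR4.sqrt (x.val * y.val) = (x.val ^ 2 ^ m + y.val ^ 2 ^ m) ^ 2 := by
    rw [add_sq, hs, hs]
    simp only [GR4.sqrt, Nat.succ_eq_add_one, Nat.add_sub_cancel, mul_pow]
    ring
  obtain ⟨w, hw⟩ := two_pow_frob (x.val ^ 2 ^ m) (y.val ^ 2 ^ m) (m + 1)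
  rw [hr, hr] at hw
  rw [hu]
  change ((x.val ^ 2 ^ m + y.val ^ 2 ^ m) ^ 2) ^ 2 ^ (m + 1) = _
  rw [pow_right_comm, hw]
  linear_combination (w * (x.val ^ 2 ^ m + y.val ^ 2 ^ m) + w ^ 2) * four_eq_zero h

/-- The addition `x ⊕ y = x + y + 2 √(x y)`, which together with the multiplication of the Galois
ring makes `T` the finite field with `2 ^ n` elements. -/
noncomputable instance : Add (Teich h) :=
  ⟨fun x y => ⟨x.val + y.val + 2 * GR4.sqrt (x.val * y.val), add_closed x y⟩⟩

end Teich

/-! ### Pseudo-planar functions -/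

/-- `f` is pseudo-planar if `x ↦ f (x + ε) + f x + ε x` is a permutation for every `ε ≠ 0`. -/
def IsPseudoPlanar {F : Type*} [Zero F] [Add F] [Mul F] (f : F → F) : Prop :=
  ∀ ε : F, ε ≠ 0 → Function.Bijective fun x => f (x + ε) + f x + ε * x

/-! ### Association schemes and Schur rings -/

open Classical in
/-- The adjacency matrix of a relation. -/
noncomputable def adjacency {X : Type*} (r : Set (X × X)) : Matrix X X ℂ :=
  Matrix.of fun x y => if (x, y) ∈ r then 1 else 0

/-- The family `Rel`, indexed by `ι`, is an association scheme on `X` whose diagonal relation has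
the index `i₀`. It is a `d`-class association scheme if `ι` has `d + 1` elements. All relations are
required to be nonempty, so that they form a partition of `X × X`. -/
structure IsAssociationScheme {ι X : Type*} [Fintype ι] [Fintype X] (i₀ : ι)
    (Rel : ι → Set (X × X)) : Prop where
  carrier_nonempty : Nonempty X
  nonempty : ∀ i, (Rel i).Nonempty
  disjoint : ∀ i j, i ≠ j → Disjoint (Rel i) (Rel j)
  cover : ⋃ i, Rel i = Set.univ
  diagonal : Rel i₀ = {p | p.1 = p.2}
  transpose : ∀ i, ∃ i', Rel i' = {p | (p.2, p.1) ∈ Rel i}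
  intersection : ∃ p : ι → ι → ι → ℕ, ∀ i j,
    adjacency (Rel i) * adjacency (Rel j) = ∑ k, (p i j k : ℂ) • adjacency (Rel k)

/-- The relation `{(x, y) | x - y ∈ S}` on an abelian group. -/
def differenceRel {X : Type*} [AddCommGroup X] (S : Set X) : Set (X × X) :=
  {p | p.1 - p.2 ∈ S}

open Classical in
/-- The family `S` (with distinguished member `S i₀`) is a Schur ring over the abelian group `X`:
the relations `x - y ∈ S i` form an association scheme. Empty members of the family, which are not
classes of the partition, are left out. -/
def IsSchurRing {ι X : Type*} [Fintype ι] [Fintype X] [AddCommGroup X] (i₀ : ι)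
    (S : ι → Set X) : Prop :=
  ∃ h₀ : (S i₀).Nonempty,
    IsAssociationScheme (ι := {i // (S i).Nonempty}) ⟨i₀, h₀⟩ fun i => differenceRel (S i.1)

/-- The character value `χ(S) = ∑_{x ∈ S} χ(x)`. -/
noncomputable def charSum {X : Type*} [AddCommGroup X] (χ : AddChar X ℂ) (S : Set X) : ℂ :=
  ∑ᶠ x ∈ S, χ x

/-- `E` is (a labelling of) the dual of the Schur ring `S`: the nonempty members of `E` are the
classes of the equivalence relation `χ(S k) = ψ(S k)` for all `k` on the character group, `E i₀`
contains only the principal character, and `E` is itself a Schur ring over the character group. -/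
structure IsDualSchurRing {ι X : Type*} [Fintype ι] [Fintype X] [AddCommGroup X] (i₀ : ι)
    (S : ι → Set X) (E : ι → Set (AddChar X ℂ)) : Prop where
  cover : ⋃ i, E i = Set.univ
  principal : E i₀ = {0}
  class_iff : ∀ i j, ∀ χ ∈ E i, ∀ ψ ∈ E j, i = j ↔ ∀ k, charSum χ (S k) = charSum ψ (S k)
  schur : IsSchurRing i₀ E

/-- `e` is a basis of the span of the matrices `A`, consisting of pairwise orthogonal
idempotents. -/
structure IsIdempotentBasis {ι X : Type*} [Fintype X] (A e : ι → Matrix X X ℂ) : Prop where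
  linearIndependent : LinearIndependent ℂ e
  span_eq : Submodule.span ℂ (Set.range e) = Submodule.span ℂ (Set.range A)
  idempotent : ∀ i, e i * e i = e i
  orthogonal : ∀ i j, i ≠ j → e i * e j = 0

/-- `P` is the first eigenmatrix: `A i = ∑ j, P j i • e j`. -/
def IsFirstEigenmatrix {ι X : Type*} [Fintype ι] (A e : ι → Matrix X X ℂ)
    (P : Matrix ι ι ℂ) : Prop :=
  ∀ i, A i = ∑ j, P j i • e j

/-- `Q` is the second eigenmatrix: `e i = |X|⁻¹ ∑ j, Q j i • A j`. -/
def IsSecondEigenmatrix {ι X : Type*} [Fintype ι] [Fintype X] (A e : ι → Matrix X X ℂ)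
    (Q : Matrix ι ι ℂ) : Prop :=
  ∀ i, e i = (Fintype.card X : ℂ)⁻¹ • ∑ j, Q j i • A j

/-! ### The partitions attached to a function on `T` -/

section Partitions

variable {n : ℕ} {h : BasicIrreducible n}

/-- `D_f = {x + 2 √(f x) | x ∈ T}`. -/
def diffSet (f : Teich h → Teich h) : Set (GR4 h) :=
  {r | ∃ x : Teich h, r = x.val + 2 * GR4.sqrt (f x).val}

/-- `Z = {2 x | x ∈ R}`. -/
def zeroDivs (h : BasicIrreducible n) : Set (GR4 h) := {r | ∃ x : GR4 h, r = 2 * x}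

/-- The elements of `R` outside `{0}`, `D_f \ {0}`, `-(D_f \ {0})` and `Z \ {0}`. -/
def remaining (f : Teich h → Teich h) : Set (GR4 h) :=
  {r | r ≠ 0 ∧ r ∉ diffSet f \ {0} ∧ -r ∉ diffSet f \ {0} ∧ r ∉ zeroDivs h \ {0}}

/-- The elements that occur in the multiset `D_f ^ 2` of all sums `x + y` with `x, y ∈ D_f`. -/
def sumsOfTwo (f : Teich h → Teich h) : Set (GR4 h) :=
  {r | ∃ x ∈ diffSet f, ∃ y ∈ diffSet f, r = x + y}

/-- The sets `S₀, …, S₅`. -/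
def schurClass (f : Teich h → Teich h) : Fin 6 → Set (GR4 h) :=
  ![{0},
    diffSet f \ {0},
    {r | -r ∈ diffSet f \ {0}},
    zeroDivs h \ {0},
    remaining f ∩ sumsOfTwo f,
    remaining f \ sumsOfTwo f]

/-- The characters of `(R, +)` with `χ(S₁) = c`. -/
def charsWithValue (f : Teich h → Teich h) (c : ℂ) : Set (AddChar (GR4 h) ℂ) :=
  {χ | charSum χ (schurClass f 1) = c}

open Classical in
/-- The sets of characters `E₀, …, E₅`. -/
noncomputable def dualClass (f : Teich h → Teich h) : Fin 6 → Set (AddChar (GR4 h) ℂ) :=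
  if Odd n then
    ![{0},
      charsWithValue f (-1),
      charsWithValue f (-1 + 2 ^ ((n - 1) / 2) + 2 ^ ((n - 1) / 2) * Complex.I),
      charsWithValue f (-1 + 2 ^ ((n - 1) / 2) - 2 ^ ((n - 1) / 2) * Complex.I),
      charsWithValue f (-1 - 2 ^ ((n - 1) / 2) + 2 ^ ((n - 1) / 2) * Complex.I),
      charsWithValue f (-1 - 2 ^ ((n - 1) / 2) - 2 ^ ((n - 1) / 2) * Complex.I)]
  else
    ![{0},
      charsWithValue f (-1),
      charsWithValue f (-1 + 2 ^ (n / 2)),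
      charsWithValue f (-1 - 2 ^ (n / 2)),
      charsWithValue f (-1 + 2 ^ (n / 2) * Complex.I),
      charsWithValue f (-1 - 2 ^ (n / 2) * Complex.I)]

end Partitions

/-! ### The eigenmatrices -/

section Eigenmatrices

open Complex

/-- The first eigenmatrix for odd `n`, with `b = 2 ^ ((n - 1) / 2)`. -/
noncomputable def oddP (b : ℂ) : Matrix (Fin 6) (Fin 6) ℂ :=
  !![1, 2*b^2 - 1, 2*b^2 - 1, 2*b^2 - 1, 2*b^4 - 3*b^2 + 1, 2*b^4 - 3*b^2 + 1;
     1, -1, -1, 2*b^2 - 1, -b^2 + 1, -b^2 + 1;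
     1, -1 + b + b*I, -1 + b - b*I, -1, (1 - b)*(1 - b*I), (1 - b)*(1 + b*I);
     1, -1 + b - b*I, -1 + b + b*I, -1, (1 - b)*(1 + b*I), (1 - b)*(1 - b*I);
     1, -1 - b + b*I, -1 - b - b*I, -1, (1 + b)*(1 - b*I), (1 + b)*(1 + b*I);
     1, -1 - b - b*I, -1 - b + b*I, -1, (1 + b)*(1 + b*I), (1 + b)*(1 - b*I)]

/-- The first eigenmatrix for even `n`, with `b = 2 ^ ((n - 2) / 2)`. -/
noncomputable def evenP (b : ℂ) : Matrix (Fin 6) (Fin 6) ℂ :=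
  !![1, 4*b^2 - 1, 4*b^2 - 1, 4*b^2 - 1, 8*b^4 - 10*b^2 + 2, 8*b^4 - 2*b^2;
     1, -1, -1, 4*b^2 - 1, -2*b^2 + 2, -2*b^2;
     1, 2*b - 1, 2*b - 1, -1, 2*b^2 - 4*b + 2, -2*b^2;
     1, -2*b - 1, -2*b - 1, -1, 2*b^2 + 4*b + 2, -2*b^2;
     1, -1 + 2*b*I, -1 - 2*b*I, -1, -2*b^2 + 2, 2*b^2;
     1, -1 - 2*b*I, -1 + 2*b*I, -1, -2*b^2 + 2, 2*b^2]

/-- The second eigenmatrix for odd `n`, with `b = 2 ^ ((n - 1) / 2)`. -/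
noncomputable def oddQ (b : ℂ) : Matrix (Fin 6) (Fin 6) ℂ :=
  !![1, 2*b^2 - 1, b/2*(2*b^3 + 2*b^2 - b - 1), b/2*(2*b^3 + 2*b^2 - b - 1),
       b/2*(2*b^3 - 2*b^2 - b + 1), b/2*(2*b^3 - 2*b^2 - b + 1);
     1, -1, b/2*(b^2 - 1 - (b^2 + b)*I), b/2*(b^2 - 1 + (b^2 + b)*I),
       b/2*(1 - b^2 - (b^2 - b)*I), b/2*(1 - b^2 + (b^2 - b)*I);
     1, -1, b/2*(b^2 - 1 + (b^2 + b)*I), b/2*(b^2 - 1 - (b^2 + b)*I),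
       b/2*(1 - b^2 + (b^2 - b)*I), b/2*(1 - b^2 - (b^2 - b)*I);
     1, 2*b^2 - 1, -(b/2)*(1 + b), -(b/2)*(1 + b), b/2*(1 - b), b/2*(1 - b);
     1, -1, -(b/2)*(1 + b*I), b/2*(-1 + b*I), b/2*(1 + b*I), b/2*(1 - b*I);
     1, -1, b/2*(-1 + b*I), -(b/2)*(1 + b*I), b/2*(1 - b*I), b*(b^2 + 1)/(2*(1 - b*I))]

/-- The second eigenmatrix for even `n`, with `b = 2 ^ ((n - 2) / 2)`. -/
noncomputable def evenQ (b : ℂ) : Matrix (Fin 6) (Fin 6) ℂ :=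
  !![1, 4*b^2 - 1, b*(4*b^3 - b + 4*b^2 - 1), b*(4*b^3 - 4*b^2 - b + 1),
       b^2*(4*b^2 - 1), b^2*(4*b^2 - 1);
     1, -1, b*(b + 2*b^2 - 1), -(2*b^2 - b - 1)*b, -b^2*(1 + 2*b*I), b^2*(-1 + 2*b*I);
     1, -1, b*(b + 2*b^2 - 1), -(2*b^2 - b - 1)*b, b^2*(-1 + 2*b*I), -b^2*(1 + 2*b*I);
     1, 4*b^2 - 1, -b*(1 + b), -b*(-1 + b), -b^2, -b^2;
     1, -1, b*(-1 + b), b*(1 + b), -b^2, -b^2;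
     1, -1, -b*(1 + b), -b*(-1 + b), b^2, b^2]

open Classical in
/-- The first eigenmatrix as a function of `n`. -/
noncomputable def eigenP (n : ℕ) : Matrix (Fin 6) (Fin 6) ℂ :=
  if Odd n then oddP (2 ^ ((n - 1) / 2)) else evenP (2 ^ ((n - 2) / 2))

open Classical in
/-- The second eigenmatrix as a function of `n`. -/
noncomputable def eigenQ (n : ℕ) : Matrix (Fin 6) (Fin 6) ℂ :=
  if Odd n then oddQ (2 ^ ((n - 1) / 2)) else evenQ (2 ^ ((n - 2) / 2))

end Eigenmatrices

/-!
Write `q = 2 ^ n`. The map `(x, c) ↦ x + 2 √c` is a bijection `T × T → R` and `c ↦ 2 √c` is additive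
(`Teich.val_add_twoSqrt_bijective`, `Teich.twoSqrt_add`). With `p(x) = x + 2 √(f x)` one computes
`p(x ⊕ ε) - p(x) = ε + 2 √(f (x ⊕ ε) ⊕ f x ⊕ ε x)`, so that pseudo-planarity says that `D_f` is a
relative difference set: every element outside `Z = 2R` is a difference of two elements of `D_f`
exactly once (`IsPseudoPlanar.existsUnique_sub`). Hence `χ(D_f)` is `q` for the principal character,
`0` for the other characters trivial on `Z`, and has absolute value `√q` for all others. Since
characters of `R` take values in the fourth roots of unity, `χ(D_f)` is a Gaussian integer, and there
are only four Gaussian integers of norm `2 ^ n`. This gives the classes `E_i`.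

The classes `S₄` and `S₅` are understood through the number `rep r` of representations of `r` as a
sum of two elements of `D_f`. It is `1` on `Z` and even elsewhere, by exchanging the summands. The
difference set property gives its second moment, and it turns out that `∑ rep r (rep r - 2)` over
`R \ Z` is zero; all terms being nonnegative, `rep` takes only the values `0` and `2` there
(`IsPseudoPlanar.rep_eq`). The Fourier coefficients of `rep` are `χ(D_f) ^ 2`. From their being real
or purely imaginary one gets `rep (-r) = rep r` for even `n` and `rep r + rep (-r) = 2` for odd `n`,
which decides on which classes `rep` is `0`, `1` or `2` (`IsPseudoPlanar.rep_of_mem_schurClass`).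
So the indicator function of `S₄` is a linear combination of `rep` and the indicators of the other
classes, and all character values `χ(S_i)` follow; they are the entries of `P`.

Since `P Q = |R|`, the matrix `P` is invertible, and any function on `R` whose Fourier coefficients
are constant on the classes `E_j` is a linear combination of the indicators of the `S_i`
(`HasEigenmatrix.eq_sum_ind`). Applied to convolutions of indicators, this yields the association
scheme; applied to the indicators of the `E_j` on the Fourier side, it yields the idempotents and
shows that the dual family has the eigenmatrix `Q`, which is invertible too. The argument does not
need all classes to be nonempty, and so it covers `n ≤ 2`.
-/

/-! ### Schur rings from character values -/

section GroupFourier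

open Matrix

variable {G J ι κ : Type*}

/-- The complex indicator function of a set. -/
noncomputable def ind (S : Set G) : G → ℂ := S.indicator 1

open Classical in
theorem ind_apply (S : Set G) (x : G) : ind S x = if x ∈ S then 1 else 0 := by
  simp [ind, Set.indicator_apply]

theorem sum_smul_ind_apply [Fintype ι] {S : ι → Set G}
    (hS : ∀ x i j, x ∈ S i → x ∈ S j → i = j) (a : ι → ℂ) {x : G} {i : ι} (hx : x ∈ S i) :
    (∑ k, a k • ind (S k)) x = a i := by
  classical
  rw [Finset.sum_apply, Finset.sum_eq_single i]
  · simp [ind_apply, hx]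
  · intro k _ hk
    have : x ∉ S k := fun h => hk (hS x k i h hx)
    simp [ind_apply, this]
  · simp

variable [AddCommGroup G]

/-- The character of the dual group given by evaluation at `-x`. The sign is the one in the Fourier
inversion formula; with it, the eigenmatrix of the dual partition is `Q` itself and not its complex
conjugate. -/
noncomputable def evalNeg (x : G) : AddChar (AddChar G ℂ) ℂ := AddChar.doubleDualEmb (-x)

@[simp]
theorem evalNeg_apply (x : G) (χ : AddChar G ℂ) : evalNeg x χ = χ (-x) := rfl

/-- The adjacency matrix of a difference relation is circulant, so that products of adjacency
matrices are convolutions of indicator functions. -/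
theorem adjacency_differenceRel (S : Set G) :
    adjacency (differenceRel S) = circulant (ind S) := by
  ext x y
  by_cases hx : x - y ∈ S <;> simp [adjacency, differenceRel, ind_apply, hx]

variable [Fintype G]

/-- The Fourier coefficient `∑ x, u x * χ x` of a function `u` at a character `χ`. -/
noncomputable def charCoeff (χ : AddChar G ℂ) : (G → ℂ) →ₗ[ℂ] ℂ where
  toFun u := ∑ x, u x * χ x
  map_add' u v := by simp [add_mul, Finset.sum_add_distrib]
  map_smul' a u := by simp [Finset.mul_sum, mul_assoc]

theorem charCoeff_apply (χ : AddChar G ℂ) (u : G → ℂ) : charCoeff χ u = ∑ x, u x * χ x := rfl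

theorem charCoeff_ind (χ : AddChar G ℂ) (S : Set G) : charCoeff χ (ind S) = charSum χ S := by
  classical
  rw [charSum, finsum_mem_def, finsum_eq_sum_of_fintype, charCoeff_apply]
  refine Finset.sum_congr rfl fun x _ => ?_
  simp [ind, Set.indicator_apply]

/-- The Fourier coefficients of a function that is constant on the classes of a partition. -/
theorem charCoeff_eq_sum [Fintype ι] {S : ι → Set G} (hS : ∀ x i j, x ∈ S i → x ∈ S j → i = j)
    (hcover : ∀ x, ∃ i, x ∈ S i) (χ : AddChar G ℂ) {u : G → ℂ} {a : ι → ℂ}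
    (hu : ∀ i, ∀ x ∈ S i, u x = a i) : charCoeff χ u = ∑ k, a k * charSum χ (S k) := by
  have h1 : u = ∑ k, a k • ind (S k) := by
    ext x
    obtain ⟨i, hi⟩ := hcover x
    rw [sum_smul_ind_apply hS a hi, hu i x hi]
  rw [h1, map_sum]
  simp [charCoeff_ind]

/-- Convolution of functions, written as the product of a circulant matrix and a vector, becomes
multiplication of Fourier coefficients. -/
theorem charCoeff_circulant_mulVec (χ : AddChar G ℂ) (u v : G → ℂ) :
    charCoeff χ (circulant u *ᵥ v) = charCoeff χ u * charCoeff χ v := by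
  simp only [charCoeff_apply, mulVec, dotProduct, circulant_apply, Finset.sum_mul]
  rw [Finset.sum_comm]
  conv_rhs => rw [← Finset.sum_mul, mul_comm, Finset.sum_mul]
  refine Finset.sum_congr rfl fun z _ => ?_
  rw [Finset.mul_sum, ← Equiv.sum_comp (Equiv.addRight z)]
  refine Finset.sum_congr rfl fun x _ => ?_
  simp only [Equiv.coe_addRight, add_sub_cancel_right, AddChar.map_add_eq_mul]
  ring

theorem charCoeff_comp_neg (χ : AddChar G ℂ) {u : G → ℂ} (hu : ∀ x, starRingEnd ℂ (u x) = u x) :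
    charCoeff χ (fun x => u (-x)) = starRingEnd ℂ (charCoeff χ u) := by
  rw [charCoeff_apply, charCoeff_apply, map_sum, ← Equiv.sum_comp (Equiv.neg G)]
  refine Finset.sum_congr rfl fun x _ => ?_
  simp [hu, AddChar.map_neg_eq_conj]

theorem charSum_neg_mem (χ : AddChar G ℂ) (S : Set G) :
    charSum χ {x | -x ∈ S} = starRingEnd ℂ (charSum χ S) := by
  classical
  rw [← charCoeff_ind, ← charCoeff_ind, ← charCoeff_comp_neg]
  · congr 1
  · intro x
    by_cases hx : x ∈ S <;> simp [ind_apply, hx]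

/-- A family of characters is separating if a function all of whose Fourier coefficients at the
family vanish is zero. -/
def IsSeparating (c : J → AddChar G ℂ) : Prop :=
  ∀ u : G → ℂ, (∀ y, charCoeff (c y) u = 0) → u = 0

/-- Fourier inversion. -/
theorem sum_charCoeff_mul (u : G → ℂ) (a : G) :
    ∑ χ : AddChar G ℂ, charCoeff χ u * χ (-a) = Fintype.card G * u a := by
  classical
  simp only [charCoeff_apply, Finset.sum_mul]
  rw [Finset.sum_comm]
  have : ∀ x, ∑ χ : AddChar G ℂ, u x * χ x * χ (-a) = if x = a then Fintype.card G * u a else 0 := by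
    intro x
    have h1 := AddChar.sum_apply_eq_ite (x + -a)
    simp only [AddChar.map_add_eq_mul] at h1
    simp only [mul_assoc, ← Finset.mul_sum, h1]
    rw [← sub_eq_add_neg]
    by_cases hx : x = a
    · simp [hx, mul_comm]
    · simp [hx, sub_eq_zero]
  simp [this]

theorem isSeparating_id : IsSeparating (id : AddChar G ℂ → AddChar G ℂ) := by
  intro u hu
  ext a
  have h := sum_charCoeff_mul u a
  simp only [id] at hu
  simp only [hu, zero_mul, Finset.sum_const_zero] at h
  have := (mul_eq_zero.1 h.symm).resolve_left (Nat.cast_ne_zero.2 Fintype.card_ne_zero)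
  simpa using this

/-- A function on the dual group is determined by its values on evaluations, because characters are
linearly independent. -/
theorem isSeparating_evalNeg : IsSeparating (evalNeg : G → AddChar (AddChar G ℂ) ℂ) := by
  intro u hu
  have h := AddChar.linearIndependent G ℂ
  rw [Fintype.linearIndependent_iff] at h
  ext χ
  refine h u ?_ χ
  ext x
  simpa [charCoeff_apply] using hu (-x)

/-- The family `S` partitions `G`, and the values on the sets `S i` of a separating family `c` of
characters are the entries of an invertible matrix `P`: the character `c y` has the row `ℓ y`. The
invertibility is expressed by a matrix `Q` with `P * Q = t`. -/
structure HasEigenmatrix [Fintype ι] [DecidableEq ι] (c : J → AddChar G ℂ) (ℓ : J → ι)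
    (S : ι → Set G) (P Q : Matrix ι ι ℂ) (t : ℂ) : Prop where
  separating : IsSeparating c
  value : ∀ y i, charSum (c y) (S i) = P (ℓ y) i
  ne_zero : t ≠ 0
  mul_eq : P * Q = t • (1 : Matrix ι ι ℂ)
  exists_mem : ∀ x, ∃ i, x ∈ S i
  eq_of_mem : ∀ x i j, x ∈ S i → x ∈ S j → i = j

namespace HasEigenmatrix

variable [Fintype ι]

/-- The function on `G` whose Fourier coefficients are the indicator of the `j`-th class of
characters, see `HasEigenmatrix.charCoeff_idem`. -/
noncomputable def idem (S : ι → Set G) (Q : Matrix ι ι ℂ) (t : ℂ) (j : ι) : G → ℂ :=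
  t⁻¹ • ∑ i, Q i j • ind (S i)

theorem isSecondEigenmatrix (S : ι → Set G) (Q : Matrix ι ι ℂ) :
    IsSecondEigenmatrix (fun i => adjacency (differenceRel (S i)))
      (fun j => circulant (idem S Q (Fintype.card G) j)) Q := by
  intro j
  ext x y
  simp [idem, adjacency_differenceRel, Matrix.sum_apply]

variable [DecidableEq ι] {c : J → AddChar G ℂ} {ℓ : J → ι}
    {S : ι → Set G} {P Q : Matrix ι ι ℂ} {t : ℂ}

theorem mul_eq' (H : HasEigenmatrix c ℓ S P Q t) : Q * P = t • (1 : Matrix ι ι ℂ) := by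
  have h1 : P * (t⁻¹ • Q) = 1 := by
    rw [Matrix.mul_smul, H.mul_eq, smul_smul, inv_mul_cancel₀ H.ne_zero, one_smul]
  rw [mul_eq_one_comm, Matrix.smul_mul] at h1
  rw [← h1, smul_smul, mul_inv_cancel₀ H.ne_zero, one_smul]

/-- A function whose Fourier coefficients depend only on the class of the character is a linear
combination of the indicator functions of the sets `S i`. -/
theorem eq_sum_ind (H : HasEigenmatrix c ℓ S P Q t) (u : G → ℂ) (a : ι → ℂ)
    (hu : ∀ y, charCoeff (c y) u = a (ℓ y)) :
    u = ∑ k, (t⁻¹ * ∑ l, Q k l * a l) • ind (S k) := by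
  rw [← sub_eq_zero]
  refine H.separating _ fun y => ?_
  have h1 : P *ᵥ (t⁻¹ • (Q *ᵥ a)) = a := by
    rw [mulVec_smul, mulVec_mulVec, H.mul_eq, smul_mulVec, one_mulVec, smul_smul,
      inv_mul_cancel₀ H.ne_zero, one_smul]
  have h2 := congrFun h1 (ℓ y)
  simp only [mulVec, dotProduct, Pi.smul_apply, smul_eq_mul] at h2
  simp only [map_sub, hu, map_sum, map_smul, charCoeff_ind, H.value, smul_eq_mul]
  rw [sub_eq_zero, ← h2]
  exact Finset.sum_congr rfl fun k _ => mul_comm _ _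

theorem sum_ind_apply (H : HasEigenmatrix c ℓ S P Q t) (a : ι → ℂ) {x : G} {i : ι}
    (hx : x ∈ S i) : (∑ k, a k • ind (S k)) x = a i :=
  sum_smul_ind_apply H.eq_of_mem a hx

/-- The span of the indicator functions of the classes is closed under convolution. -/
theorem conv_eq (H : HasEigenmatrix c ℓ S P Q t) (i j : ι) :
    ∃ a : ι → ℂ, circulant (ind (S i)) *ᵥ ind (S j) = ∑ k, a k • ind (S k) :=
  ⟨_, H.eq_sum_ind _ (fun l => P l i * P l j) fun y => by
    rw [charCoeff_circulant_mulVec, charCoeff_ind, charCoeff_ind, H.value, H.value]⟩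

/-- The class `S i` is mapped by negation to the class whose column in `P` is the complex
conjugate. -/
theorem neg_mem_iff (H : HasEigenmatrix c ℓ S P Q t) {σ : ι → ι}
    (hσ : ∀ l i, starRingEnd ℂ (P l i) = P l (σ i)) (i : ι) (x : G) :
    x ∈ S (σ i) ↔ -x ∈ S i := by
  classical
  have h : ind (S (σ i)) - ind {x | -x ∈ S i} = 0 := by
    refine H.separating _ fun y => ?_
    rw [map_sub, charCoeff_ind, charCoeff_ind, charSum_neg_mem, H.value, H.value, hσ, sub_self]
  have hx := congrFun h x
  simp only [Pi.sub_apply, ind_apply, Pi.zero_apply, Set.mem_ofPred_eq, sub_eq_zero] at hx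
  by_cases h1 : x ∈ S (σ i) <;> by_cases h2 : -x ∈ S i <;> simp_all

open Classical in
theorem circulant_ind_mulVec_apply (S T : Set G) (x : G) :
    (circulant (ind S) *ᵥ ind T) x = ((Finset.univ.filter fun z => x - z ∈ S ∧ z ∈ T).card : ℂ) := by
  simp only [mulVec, dotProduct, circulant_apply, ind_apply]
  rw [Finset.card_filter]
  push_cast
  refine Finset.sum_congr rfl fun z _ => ?_
  by_cases h1 : x - z ∈ S <;> by_cases h2 : z ∈ T <;> simp [h1, h2]

/-- A subfamily of the partition that contains all nonempty classes gives an association scheme.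
The subfamily is given by an injection `r`. -/
theorem isAssociationScheme [Fintype κ] (H : HasEigenmatrix c ℓ S P Q t) {σ : ι → ι}
    (hσ : ∀ l i, starRingEnd ℂ (P l i) = P l (σ i)) (r : κ → ι) (hr : Function.Injective r)
    (hne : ∀ k, (S (r k)).Nonempty) (hsurj : ∀ i, (S i).Nonempty → ∃ k, r k = i)
    (k₀ : κ) (h₀ : S (r k₀) = {0}) :
    IsAssociationScheme k₀ fun k => differenceRel (S (r k)) where
  carrier_nonempty := ⟨0⟩
  nonempty k := by
    obtain ⟨x, hx⟩ := hne k
    exact ⟨(x, 0), by simpa [differenceRel] using hx⟩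
  disjoint i j hij := Set.disjoint_left.2 fun p hi hj => hij (hr (H.eq_of_mem _ _ _ hi hj))
  cover := by
    refine Set.eq_univ_of_forall fun p => ?_
    obtain ⟨i, hi⟩ := H.exists_mem (p.1 - p.2)
    obtain ⟨k, rfl⟩ := hsurj i ⟨_, hi⟩
    exact Set.mem_iUnion.2 ⟨k, hi⟩
  diagonal := by
    ext p
    simp [differenceRel, h₀, sub_eq_zero]
  transpose k := by
    obtain ⟨x, hx⟩ := hne k
    obtain ⟨k', hk'⟩ := hsurj (σ (r k)) ⟨-x, by rwa [H.neg_mem_iff hσ, neg_neg]⟩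
    refine ⟨k', ?_⟩
    ext p
    simp [differenceRel, hk', H.neg_mem_iff hσ]
  intersection := by
    classical
    -- The structure constants are natural numbers since convolutions of indicators count pairs.
    have key : ∀ i j k : κ, ∃ m : ℕ, ∀ x ∈ S (r k),
        (circulant (ind (S (r i))) *ᵥ ind (S (r j))) x = m := by
      intro i j k
      obtain ⟨a, ha⟩ := H.conv_eq (r i) (r j)
      obtain ⟨x₀, hx₀⟩ := hne k
      refine ⟨(Finset.univ.filter fun z => x₀ - z ∈ S (r i) ∧ z ∈ S (r j)).card, fun x hx => ?_⟩
      rw [ha, H.sum_ind_apply _ hx, ← H.sum_ind_apply a hx₀, ← ha, circulant_ind_mulVec_apply]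
    choose p hp using key
    refine ⟨p, fun i j => ?_⟩
    simp only [adjacency_differenceRel]
    rw [circulant_mul]
    ext x y
    obtain ⟨l, hl⟩ := H.exists_mem (x - y)
    obtain ⟨k, rfl⟩ := hsurj l ⟨_, hl⟩
    rw [circulant_apply, hp i j k _ hl, Matrix.sum_apply, Finset.sum_eq_single k]
    · simp [ind_apply, hl]
    · intro k' _ hk'
      have : x - y ∉ S (r k') := fun h => hk' (hr (H.eq_of_mem _ _ _ h hl))
      simp [ind_apply, this]
    · simp

open Classical in
/-- Empty classes do no harm: the invertible matrix `P` may have more rows and columns than there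
are classes. -/
theorem isSchurRing (H : HasEigenmatrix c ℓ S P Q t) {σ : ι → ι}
    (hσ : ∀ l i, starRingEnd ℂ (P l i) = P l (σ i)) {i₀ : ι} (h₀ : S i₀ = {0}) :
    IsSchurRing i₀ S :=
  ⟨by simp [h₀], H.isAssociationScheme hσ Subtype.val Subtype.val_injective (fun k => k.2)
    (fun i hi => ⟨⟨i, hi⟩, rfl⟩) _ h₀⟩

theorem charCoeff_idem (H : HasEigenmatrix c ℓ S P Q t) (j : ι) (y : J) :
    charCoeff (c y) (idem S Q t j) = if ℓ y = j then 1 else 0 := by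
  have h := congrFun (congrFun H.mul_eq (ℓ y)) j
  simp only [Matrix.mul_apply, Matrix.smul_apply, Matrix.one_apply, smul_eq_mul] at h
  simp only [idem, map_smul, map_sum, charCoeff_ind, H.value, smul_eq_mul, mul_comm (Q _ _), h]
  rw [← mul_assoc, inv_mul_cancel₀ H.ne_zero, one_mul]

/-- The functions `idem` span the same space as the indicator functions and are orthogonal
idempotents for convolution. -/
theorem isIdempotentBasis (H : HasEigenmatrix c ℓ S P Q t) (hne : ∀ i, (S i).Nonempty) :
    IsIdempotentBasis (fun i => adjacency (differenceRel (S i)))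
        (fun j => circulant (idem S Q t j)) ∧
      IsFirstEigenmatrix (fun i => adjacency (differenceRel (S i)))
        (fun j => circulant (idem S Q t j)) P := by
  have hA : ∀ i, ind (S i) = ∑ j, P j i • idem S Q t j := by
    intro i
    have h2 : ∀ j, P j i • idem S Q t j = ∑ k, (t⁻¹ * (Q k j * P j i)) • ind (S k) := by
      intro j
      rw [idem, Finset.smul_sum, Finset.smul_sum]
      refine Finset.sum_congr rfl fun k _ => ?_
      rw [smul_smul, smul_smul]
      ring_nf
    simp only [h2]
    rw [Finset.sum_comm]
    have h3 : ∀ k, ∑ j, (t⁻¹ * (Q k j * P j i)) • ind (S k)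
        = (if k = i then (1 : ℂ) else 0) • ind (S k) := by
      intro k
      rw [← Finset.sum_smul, ← Finset.mul_sum, ← Matrix.mul_apply, H.mul_eq']
      simp only [Matrix.smul_apply, Matrix.one_apply, smul_eq_mul]
      rw [← mul_assoc, inv_mul_cancel₀ H.ne_zero, one_mul]
    simp [h3]
  have hsum : ∀ (s : Finset ι) (v : ι → G → ℂ),
      circulant (∑ j ∈ s, v j) = ∑ j ∈ s, circulant (v j) := by
    intro s v
    ext x y
    simp [Matrix.sum_apply]
  have hfirst : IsFirstEigenmatrix (fun i => adjacency (differenceRel (S i)))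
        (fun j => circulant (idem S Q t j)) P := by
    intro i
    simp only [adjacency_differenceRel]
    rw [hA i, hsum]
    simp only [circulant_smul]
  have hspan : Submodule.span ℂ (Set.range fun j => circulant (idem S Q t j)) =
      Submodule.span ℂ (Set.range fun i => adjacency (differenceRel (S i))) := by
    refine le_antisymm (Submodule.span_le.2 ?_) (Submodule.span_le.2 ?_)
    · rintro _ ⟨j, rfl⟩
      simp only [idem, circulant_smul, hsum]
      refine Submodule.smul_mem _ _ (Submodule.sum_mem _ fun i _ => Submodule.smul_mem _ _ ?_)
      exact Submodule.subset_span ⟨i, adjacency_differenceRel _⟩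
    · rintro _ ⟨i, rfl⟩
      have := hfirst i
      rw [this]
      exact Submodule.sum_mem _ fun j _ =>
        Submodule.smul_mem _ _ (Submodule.subset_span ⟨j, rfl⟩)
  have hlin : LinearIndependent ℂ fun i => adjacency (differenceRel (S i)) := by
    rw [Fintype.linearIndependent_iff]
    intro g hg i
    obtain ⟨x, hx⟩ := hne i
    have h1 := congrFun (congrFun hg x) 0
    simp only [adjacency_differenceRel, ← circulant_smul, ← hsum] at h1
    rwa [circulant_apply, sub_zero, H.sum_ind_apply g hx] at h1
  have hmul : ∀ i j, circulant (idem S Q t i) * circulant (idem S Q t j) =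
      if i = j then circulant (idem S Q t i) else 0 := by
    intro i j
    rw [circulant_mul]
    have h1 : circulant (idem S Q t i) *ᵥ idem S Q t j - (if i = j then idem S Q t i else 0) = 0 := by
      refine H.separating _ fun y => ?_
      rw [map_sub, charCoeff_circulant_mulVec]
      by_cases hij : i = j
      · subst hij
        by_cases hi : ℓ y = i <;> simp [H.charCoeff_idem, hi]
      · by_cases hi : ℓ y = i
        · simp [H.charCoeff_idem, hij, hi]
        · simp [H.charCoeff_idem, hij, hi]
    rw [sub_eq_zero.1 h1]
    split_ifs <;> simp
  refine ⟨⟨?_, hspan, fun i => by simp [hmul], fun i j hij => by simp [hmul, hij]⟩, hfirst⟩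
  rw [linearIndependent_iff_card_eq_finrank_span, Set.finrank, hspan,
    linearIndependent_iff_card_eq_finrank_span.1 hlin, Set.finrank]

/-- The dual family: if the classes of all characters are `E j`, then the values of the evaluation
characters on the sets `E j` are the entries of `Q`. -/
theorem dual {ℓ : AddChar G ℂ → ι} (H : HasEigenmatrix id ℓ S P Q (Fintype.card G))
    {m : G → ι} (hm : ∀ x, x ∈ S (m x)) {E : ι → Set (AddChar G ℂ)}
    (hE : ∀ χ j, χ ∈ E j ↔ ℓ χ = j) :
    HasEigenmatrix evalNeg m E Q P (Fintype.card G) where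
  separating := isSeparating_evalNeg
  ne_zero := H.ne_zero
  mul_eq := H.mul_eq'
  exists_mem χ := ⟨ℓ χ, (hE _ _).2 rfl⟩
  eq_of_mem χ i j hi hj := ((hE _ _).1 hi).symm.trans ((hE _ _).1 hj)
  value x j := by
    classical
    have h := sum_charCoeff_mul (idem S Q (Fintype.card G) j) x
    have h1 : ∀ χ : AddChar G ℂ, charCoeff χ (idem S Q (Fintype.card G) j) = ind (E j) χ :=
      fun χ => (H.charCoeff_idem j χ).trans (by simp [ind_apply, hE])
    simp only [h1] at h
    rw [← charCoeff_ind, charCoeff_apply]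
    simp only [evalNeg_apply, h]
    rw [idem, Pi.smul_apply, H.sum_ind_apply (fun i => Q i j) (hm x), smul_eq_mul, ← mul_assoc,
      mul_inv_cancel₀ H.ne_zero, one_mul]

end HasEigenmatrix

end GroupFourier

/-! ### The residue field and the Teichmüller system -/

section GaloisRing

theorem zmod_cast_eq_zero_iff (a : ZMod 4) :
    ZMod.castHom (show 2 ∣ 4 by norm_num) (ZMod 2) a = 0 ↔ 2 * a = 0 := by
  revert a; decide

theorem exists_two_mul_of_two_mul_eq_zero (a : ZMod 4) (ha : 2 * a = 0) : ∃ b, a = 2 * b := by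
  revert a; decide

/-- A polynomial over `ℤ/4` vanishes modulo `2` if and only if it is annihilated by `2`. -/
theorem poly_map_eq_zero_iff (p : (ZMod 4)[X]) :
    p.map (ZMod.castHom (show 2 ∣ 4 by norm_num) (ZMod 2)) = 0 ↔ 2 * p = 0 := by
  simp only [Polynomial.ext_iff, coeff_map, coeff_zero, zmod_cast_eq_zero_iff, coeff_ofNat_mul]

theorem exists_two_mul_of_poly_map_eq_zero (p : (ZMod 4)[X])
    (hp : p.map (ZMod.castHom (show 2 ∣ 4 by norm_num) (ZMod 2)) = 0) : ∃ r, p = 2 * r := by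
  rw [poly_map_eq_zero_iff, Polynomial.ext_iff] at hp
  have h1 : ∀ k, ∃ b, p.coeff k = 2 * b := fun k =>
    exists_two_mul_of_two_mul_eq_zero _ (by simpa [coeff_ofNat_mul] using hp k)
  choose b hb using h1
  refine ⟨∑ k ∈ p.support, monomial k (b k), ?_⟩
  conv_lhs => rw [p.as_sum_support]
  rw [Finset.mul_sum]
  refine Finset.sum_congr rfl fun k _ => ?_
  rw [hb k]
  ext m
  simp [coeff_ofNat_mul, coeff_monomial]

variable {n : ℕ} (h : BasicIrreducible n)

/-- The residue field `R / 2R` with `2 ^ n` elements. -/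
abbrev ResidueField4 : Type :=
  AdjoinRoot (h.poly.map (ZMod.castHom (show 2 ∣ 4 by norm_num) (ZMod 2)))

instance ResidueField4.fact_irreducible :
    Fact (Irreducible (h.poly.map (ZMod.castHom (show 2 ∣ 4 by norm_num) (ZMod 2)))) :=
  ⟨h.irreducible_map⟩

instance ResidueField4.instFinite : Finite (ResidueField4 h) :=
  haveI := (h.monic.map (ZMod.castHom (show 2 ∣ 4 by norm_num) (ZMod 2))).finite_adjoinRoot
  Module.finite_of_finite (ZMod 2)

noncomputable instance ResidueField4.instFintype : Fintype (ResidueField4 h) := Fintype.ofFinite _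

theorem ResidueField4.card : Fintype.card (ResidueField4 h) = 2 ^ n := by
  have hm := h.monic.map (ZMod.castHom (show 2 ∣ 4 by norm_num) (ZMod 2))
  rw [Fintype.card_congr (AdjoinRoot.powerBasis' hm).basis.equivFun.toEquiv, Fintype.card_fun,
    ZMod.card, Fintype.card_fin, AdjoinRoot.powerBasis'_dim, h.monic.natDegree_map, h.natDegree_eq]

theorem ResidueField4.two_eq_zero : (2 : ResidueField4 h) = 0 := by
  have h4 : (2 : ZMod 2) = 0 := by decide
  have := congrArg (algebraMap (ZMod 2) (ResidueField4 h)) h4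
  rwa [map_zero, map_ofNat] at this

variable {h}

/-- Reduction modulo `2`. -/
noncomputable def res : GR4 h →+* ResidueField4 h :=
  AdjoinRoot.map (ZMod.castHom (show 2 ∣ 4 by norm_num) (ZMod 2)) _ _ dvd_rfl

theorem res_mk (p : (ZMod 4)[X]) : res (AdjoinRoot.mk h.poly p) =
    AdjoinRoot.mk _ (p.map (ZMod.castHom (show 2 ∣ 4 by norm_num) (ZMod 2))) := by
  rw [res, AdjoinRoot.map, AdjoinRoot.lift_mk, ← eval₂_map, ← AdjoinRoot.algebraMap_eq, ← aeval_def,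
    AdjoinRoot.aeval_eq]

theorem res_surjective : Function.Surjective (res (h := h)) := by
  intro y
  obtain ⟨p, rfl⟩ := AdjoinRoot.mk_surjective y
  obtain ⟨r, rfl⟩ := Polynomial.map_surjective
    (ZMod.castHom (show 2 ∣ 4 by norm_num) (ZMod 2)) (ZMod.castHom_surjective _) p
  exact ⟨AdjoinRoot.mk _ r, res_mk r⟩

theorem res_two_mul (x : GR4 h) : res (2 * x) = 0 := by
  rw [map_mul, map_ofNat, ResidueField4.two_eq_zero, zero_mul]

theorem exists_two_mul_of_res_eq_zero {x : GR4 h} (hx : res x = 0) : ∃ y, x = 2 * y := by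
  obtain ⟨p, rfl⟩ := AdjoinRoot.mk_surjective x
  rw [res_mk, AdjoinRoot.mk_eq_zero] at hx
  obtain ⟨w, hw⟩ := hx
  obtain ⟨v, rfl⟩ := Polynomial.map_surjective
    (ZMod.castHom (show 2 ∣ 4 by norm_num) (ZMod 2)) (ZMod.castHom_surjective _) w
  obtain ⟨r, hr⟩ := exists_two_mul_of_poly_map_eq_zero (p - h.poly * v) (by
    rw [Polynomial.map_sub, Polynomial.map_mul, hw, sub_self])
  refine ⟨AdjoinRoot.mk _ r, ?_⟩
  rw [sub_eq_iff_eq_add.1 hr, map_add, map_mul, map_mul, AdjoinRoot.mk_self, zero_mul, add_zero,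
    map_ofNat]

theorem mem_zeroDivs_iff {x : GR4 h} : x ∈ zeroDivs h ↔ res x = 0 :=
  ⟨by rintro ⟨y, rfl⟩; exact res_two_mul y, exists_two_mul_of_res_eq_zero⟩

/-- The annihilator of `2` is the kernel of the reduction, which is `2R`. -/
theorem two_mul_eq_zero_iff {x : GR4 h} : 2 * x = 0 ↔ res x = 0 := by
  constructor
  · intro hx
    obtain ⟨p, rfl⟩ := AdjoinRoot.mk_surjective x
    have h1 : AdjoinRoot.mk h.poly (2 * p) = 0 := by
      rwa [map_mul, map_ofNat]
    rw [AdjoinRoot.mk_eq_zero] at h1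
    obtain ⟨w, hw⟩ := h1
    have h2 := congrArg (Polynomial.map (ZMod.castHom (show 2 ∣ 4 by norm_num) (ZMod 2))) hw
    rw [Polynomial.map_mul, Polynomial.map_mul, (poly_map_eq_zero_iff 2).2 (by
      rw [← C_ofNat, ← C_mul]; exact C_eq_zero.2 (by decide)), zero_mul] at h2
    have h3 := (mul_eq_zero.1 h2.symm).resolve_left h.irreducible_map.ne_zero
    obtain ⟨v, rfl⟩ := exists_two_mul_of_poly_map_eq_zero w h3
    have h4 : 2 * (p - h.poly * v) = 0 := by rw [mul_sub, hw]; ring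
    rw [← poly_map_eq_zero_iff, Polynomial.map_sub, sub_eq_zero] at h4
    rw [res_mk, h4, Polynomial.map_mul, AdjoinRoot.mk_eq_zero]
    exact dvd_mul_right _ _
  · intro hx
    obtain ⟨y, rfl⟩ := exists_two_mul_of_res_eq_zero hx
    rw [← mul_assoc]
    norm_num
    rw [Teich.four_eq_zero, zero_mul]

theorem two_mul_eq_iff {x y : GR4 h} : 2 * x = 2 * y ↔ res x = res y := by
  rw [← sub_eq_zero, ← mul_sub, two_mul_eq_zero_iff, map_sub, sub_eq_zero]

theorem neg_two_mul (x : GR4 h) : -(2 * x) = 2 * x := by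
  rw [neg_eq_iff_add_eq_zero, ← two_mul, ← mul_assoc]
  norm_num
  rw [Teich.four_eq_zero, zero_mul]

theorem degree_ne_zero (h : BasicIrreducible n) : n ≠ 0 := by
  rintro rfl
  have h1 : h.poly = 1 := Polynomial.eq_one_of_monic_natDegree_zero h.monic h.natDegree_eq
  have := h.irreducible_map.not_isUnit
  simp [h1] at this

theorem ResidueField4.pow_card (y : ResidueField4 h) : y ^ 2 ^ n = y := by
  rw [← ResidueField4.card h, FiniteField.pow_card]

/-- Squaring loses the second `2`-adic digit. Hence `r ↦ r ^ (2 ^ n)` depends only on the residue of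
`r`; it is the Teichmüller lift. -/
theorem sq_eq_of_res_eq {x y : GR4 h} (hxy : res x = res y) : x ^ 2 = y ^ 2 := by
  obtain ⟨z, hz⟩ := exists_two_mul_of_res_eq_zero (x := x - y) (by rw [map_sub, hxy, sub_self])
  rw [sub_eq_iff_eq_add.1 hz]
  linear_combination (z * y + z ^ 2) * Teich.four_eq_zero h

theorem pow_eq_of_res_eq {x y : GR4 h} (hxy : res x = res y) : x ^ 2 ^ n = y ^ 2 ^ n := by
  obtain ⟨m, hm⟩ := Nat.exists_eq_succ_of_ne_zero (degree_ne_zero h)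
  have : 2 ^ n = 2 * 2 ^ m := by rw [hm, pow_succ, mul_comm]
  rw [this, pow_mul, pow_mul, sq_eq_of_res_eq hxy]

namespace Teich

theorem res_injective : Function.Injective fun x : Teich h => res x.val := by
  intro x y hxy
  ext
  rw [← x.pow_eq, ← y.pow_eq, pow_eq_of_res_eq hxy]

/-- `T` is a system of representatives of `R` modulo `2R`. -/
theorem res_bijective : Function.Bijective fun x : Teich h => res x.val := by
  refine ⟨res_injective, fun y => ?_⟩
  obtain ⟨r, rfl⟩ := res_surjective y
  have hr : res (r ^ 2 ^ n) = res r := by rw [map_pow, ResidueField4.pow_card]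
  exact ⟨⟨r ^ 2 ^ n, pow_eq_of_res_eq hr⟩, hr⟩

theorem res_inj {x y : Teich h} : res x.val = res y.val ↔ x = y := res_injective.eq_iff

instance : Finite (Teich h) := Finite.of_injective _ (res_injective (h := h))

noncomputable instance : Fintype (Teich h) := Fintype.ofFinite _

noncomputable instance : DecidableEq (Teich h) := Classical.decEq _

theorem card_eq : Fintype.card (Teich h) = 2 ^ n := by
  rw [Fintype.card_of_bijective (res_bijective (h := h)), ResidueField4.card]

@[simp] theorem val_zero : (0 : Teich h).val = 0 := rfl

@[simp] theorem val_mul (x y : Teich h) : (x * y).val = x.val * y.val := rfl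

theorem val_add (x y : Teich h) :
    (x + y).val = x.val + y.val + 2 * GR4.sqrt (x.val * y.val) := rfl

theorem res_add (x y : Teich h) : res (x + y).val = res x.val + res y.val := by
  rw [val_add, map_add, res_two_mul, add_zero, map_add]

protected theorem add_comm (x y : Teich h) : x + y = y + x := by
  rw [← res_inj, res_add, res_add, add_comm]

protected theorem add_assoc (x y z : Teich h) : x + y + z = x + (y + z) := by
  rw [← res_inj, res_add, res_add, res_add, res_add, add_assoc]

protected theorem add_zero (x : Teich h) : x + 0 = x := by
  rw [← res_inj, res_add, val_zero, map_zero, add_zero]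

theorem add_self (x : Teich h) : x + x = 0 := by
  rw [← res_inj, res_add, ← two_mul, ResidueField4.two_eq_zero, zero_mul, val_zero, map_zero]

theorem add_add_cancel (x y : Teich h) : x + (x + y) = y := by
  rw [← Teich.add_assoc, add_self, Teich.add_comm, Teich.add_zero]

/-- The bijection `c ↦ 2 √c` from `T` to `2R`. It is additive, which makes the set `2R` a copy of
the additive group of the field `T`. -/
noncomputable def twoSqrt (c : Teich h) : GR4 h := 2 * GR4.sqrt c.val

theorem twoSqrt_add (c d : Teich h) : twoSqrt (c + d) = twoSqrt c + twoSqrt d := by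
  rw [twoSqrt, twoSqrt, twoSqrt, ← mul_add, two_mul_eq_iff]
  simp only [GR4.sqrt]
  have : CharP (ResidueField4 h) 2 := CharTwo.of_one_ne_zero_of_two_eq_zero one_ne_zero
    (ResidueField4.two_eq_zero h)
  rw [map_pow, res_add, map_add, map_pow, map_pow, add_pow_char_pow]

@[simp] theorem twoSqrt_zero : twoSqrt (0 : Teich h) = 0 := by
  simp [twoSqrt, GR4.sqrt]

theorem neg_twoSqrt (c : Teich h) : -twoSqrt c = twoSqrt c := neg_two_mul _

@[simp] theorem res_twoSqrt (c : Teich h) : res (twoSqrt c) = 0 := res_two_mul _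

theorem sqrt_sq (x : GR4 h) : GR4.sqrt x ^ 2 = x ^ 2 ^ n := by
  rw [GR4.sqrt, ← pow_mul, ← pow_succ,
    Nat.sub_add_cancel (Nat.one_le_iff_ne_zero.2 (degree_ne_zero h))]

theorem twoSqrt_injective : Function.Injective (twoSqrt (h := h)) := by
  intro c d hcd
  have := sq_eq_of_res_eq (two_mul_eq_iff.1 hcd)
  rw [sqrt_sq, sqrt_sq, c.pow_eq, d.pow_eq] at this
  exact Teich.ext this

theorem twoSqrt_mul_self (x : Teich h) : twoSqrt (x * x) = 2 * x.val := by
  rw [twoSqrt, val_mul, ← pow_two, GR4.sqrt, pow_right_comm]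
  change 2 * GR4.sqrt x.val ^ 2 = _
  rw [sqrt_sq, x.pow_eq]

theorem mul_self_injective : Function.Injective fun x : Teich h => x * x := by
  intro x y hxy
  have := congrArg twoSqrt hxy
  simp only [twoSqrt_mul_self, two_mul_eq_iff] at this
  exact res_injective this

/-- Every element of `R` is `x + 2 √c` for unique `x, c ∈ T`. -/
theorem val_add_twoSqrt_bijective :
    Function.Bijective fun p : Teich h × Teich h => p.1.val + twoSqrt p.2 := by
  constructor
  · rintro ⟨x, c⟩ ⟨y, d⟩ hxy
    have h1 : x = y := by
      have := congrArg res hxy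
      simpa [res_inj] using this
    subst h1
    simpa using twoSqrt_injective (add_left_cancel hxy)
  · intro r
    obtain ⟨x, hx⟩ := res_bijective.2 (res r)
    obtain ⟨y, hy⟩ := exists_two_mul_of_res_eq_zero (x := r - x.val) (by
      rw [map_sub, ← hx, sub_self])
    obtain ⟨w, hw⟩ := res_bijective.2 (res y)
    refine ⟨⟨x, w * w⟩, ?_⟩
    -- `twoSqrt (w * w) = 2 * w`, so that `w` has to lift the residue of `y`.
    simp only [twoSqrt_mul_self, two_mul_eq_iff.2 hw, ← hy]
    ring

theorem mem_zeroDivs_iff_exists {r : GR4 h} : r ∈ zeroDivs h ↔ ∃ c, r = twoSqrt c := by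
  rw [mem_zeroDivs_iff]
  constructor
  · intro hr
    obtain ⟨⟨x, c⟩, rfl⟩ := val_add_twoSqrt_bijective.2 r
    have : x = 0 := by simpa [← res_inj] using hr
    exact ⟨c, by simp [this]⟩
  · rintro ⟨c, rfl⟩
    exact res_twoSqrt c

end Teich

theorem GR4.card : Fintype.card (GR4 h) = 2 ^ n * 2 ^ n := by
  rw [← Fintype.card_of_bijective (Teich.val_add_twoSqrt_bijective (h := h)), Fintype.card_prod,
    Teich.card_eq]

end GaloisRing

/-! ### The relative difference set of a pseudo-planar function -/

section DifferenceSet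

variable {n : ℕ} {h : BasicIrreducible n} (f : Teich h → Teich h)

/-- The element `x + 2 √(f x)` of `D_f`. -/
noncomputable def point (x : Teich h) : GR4 h := x.val + Teich.twoSqrt (f x)

@[simp]
theorem res_point (x : Teich h) : res (point f x) = res x.val := by
  rw [point, map_add, Teich.res_twoSqrt, add_zero]

theorem point_injective : Function.Injective (point f) := by
  intro x y hxy
  have := congrArg res hxy
  rwa [res_point, res_point, Teich.res_inj] at this

theorem diffSet_eq_range : diffSet f = Set.range (point f) := by
  ext r
  exact ⟨fun ⟨x, hx⟩ => ⟨x, hx.symm⟩, fun ⟨x, hx⟩ => ⟨x, hx.symm⟩⟩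

theorem zeroDivs_eq_range : zeroDivs h = Set.range (Teich.twoSqrt (h := h)) := by
  ext r
  rw [Teich.mem_zeroDivs_iff_exists]
  exact ⟨fun ⟨x, hx⟩ => ⟨x, hx.symm⟩, fun ⟨x, hx⟩ => ⟨x, hx.symm⟩⟩

/-- The differences of elements of `D_f` in terms of the function that is bijective because `f` is
pseudo-planar. -/
theorem point_add_sub (x ε : Teich h) :
    point f (x + ε) - point f x = ε.val + Teich.twoSqrt (f (x + ε) + f x + ε * x) := by
  have h1 : (x + ε).val = x.val + ε.val + Teich.twoSqrt (ε * x) := by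
    rw [Teich.val_add, Teich.twoSqrt, Teich.val_mul, mul_comm ε.val]
  rw [point, point, h1, Teich.twoSqrt_add, Teich.twoSqrt_add]
  linear_combination Teich.neg_twoSqrt (f x)

theorem point_add_self (x : Teich h) : point f x + point f x = Teich.twoSqrt (x * x) := by
  rw [Teich.twoSqrt_mul_self, point]
  linear_combination -Teich.neg_twoSqrt (f x)

/-- Two elements of `D_f` with sum in `2R` are congruent modulo `2`, hence equal. -/
theorem eq_of_point_add_mem {x y : Teich h} (hxy : point f x + point f y ∈ zeroDivs h) :
    x = y := by
  rw [mem_zeroDivs_iff, map_add, res_point, res_point, ← Teich.res_add] at hxy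
  have h1 : x + y = 0 := by
    rw [← Teich.res_inj, hxy, Teich.val_zero, map_zero]
  rw [← Teich.add_add_cancel x y, h1, Teich.add_zero]

variable {f}

/-- `D_f` is a relative difference set: every element outside `2R` is a difference of two elements
of `D_f` in exactly one way. -/
theorem IsPseudoPlanar.existsUnique_sub (hf : IsPseudoPlanar f) {r : GR4 h} (hr : res r ≠ 0) :
    ∃! p : Teich h × Teich h, point f p.1 - point f p.2 = r := by
  obtain ⟨⟨ε, c⟩, rfl⟩ := Teich.val_add_twoSqrt_bijective.2 r
  have hε : ε ≠ 0 := by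
    rintro rfl
    simp at hr
  obtain ⟨x, hx⟩ := (hf ε hε).2 c
  refine ⟨(x + ε, x), ?_, ?_⟩
  · simp only [point_add_sub] at hx ⊢
    rw [hx]
  · rintro ⟨y, x'⟩ hy
    obtain ⟨ε', rfl⟩ : ∃ ε', y = x' + ε' := ⟨x' + y, (Teich.add_add_cancel x' y).symm⟩
    simp only [point_add_sub] at hy
    have h1 := Teich.val_add_twoSqrt_bijective.1
      (a₁ := (ε', f (x' + ε') + f x' + ε' * x')) (a₂ := (ε, c)) hy
    rw [Prod.mk.injEq] at h1
    obtain ⟨rfl, h2⟩ := h1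
    have : x' = x := (hf ε' hε).1 (h2.trans hx.symm)
    rw [this]

variable (f)

open Classical in
/-- The number of representations of `r` as an ordered sum of two elements of `D_f`. -/
noncomputable def rep (r : GR4 h) : ℕ :=
  (Finset.univ.filter fun p : Teich h × Teich h => point f p.1 + point f p.2 = r).card

open Classical in
theorem rep_eq_sum (r : GR4 h) :
    rep f r = ∑ p : Teich h × Teich h, if point f p.1 + point f p.2 = r then 1 else 0 := by
  rw [rep, Finset.card_filter]

theorem sum_rep : ∑ r, rep f r = 2 ^ n * 2 ^ n := by
  classical
  simp only [rep_eq_sum]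
  rw [Finset.sum_comm]
  simp [Teich.card_eq]

theorem rep_pos_iff (r : GR4 h) : 0 < rep f r ↔ r ∈ sumsOfTwo f := by
  classical
  rw [rep, Finset.card_pos]
  constructor
  · rintro ⟨p, hp⟩
    exact ⟨_, ⟨p.1, rfl⟩, _, ⟨p.2, rfl⟩, (Finset.mem_filter.1 hp).2.symm⟩
  · rintro ⟨_, ⟨x, rfl⟩, _, ⟨y, rfl⟩, hr⟩
    exact ⟨(x, y), Finset.mem_filter.2 ⟨Finset.mem_univ _, hr.symm⟩⟩

/-- On `2R` the only representation is the one with equal summands. -/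
theorem rep_of_mem_zeroDivs {r : GR4 h} (hr : r ∈ zeroDivs h) : rep f r = 1 := by
  classical
  obtain ⟨c, rfl⟩ := Teich.mem_zeroDivs_iff_exists.1 hr
  obtain ⟨x, rfl⟩ := Finite.surjective_of_injective Teich.mul_self_injective c
  rw [rep, Finset.card_eq_one]
  refine ⟨(x, x), ?_⟩
  ext ⟨y, z⟩
  simp only [Finset.mem_filter, Finset.mem_univ, true_and, Finset.mem_singleton, Prod.mk.injEq]
  constructor
  · intro hyz
    obtain rfl := eq_of_point_add_mem f (hyz ▸ hr)
    rw [point_add_self] at hyz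
    have := Teich.mul_self_injective (Teich.twoSqrt_injective hyz)
    exact ⟨this, this⟩
  · rintro ⟨rfl, rfl⟩
    exact point_add_self f _

/-- Outside `2R` the two summands are distinct, so that they can be exchanged. -/
theorem even_rep {r : GR4 h} (hr : r ∉ zeroDivs h) : Even (rep f r) := by
  classical
  rw [← ZMod.natCast_eq_zero_iff_even, rep, Finset.card_eq_sum_ones, Nat.cast_sum]
  refine Finset.sum_involution (fun p _ => p.swap) ?_ ?_ ?_ ?_
  · intro p _
    decide
  · rintro ⟨x, y⟩ hp _ hxy
    have hp := (Finset.mem_filter.1 hp).2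
    obtain rfl : y = x := (Prod.mk.inj hxy).1
    refine hr ?_
    rw [← hp, point_add_self]
    exact Teich.mem_zeroDivs_iff_exists.2 ⟨_, rfl⟩
  · intro p hp
    rw [Finset.mem_filter] at hp ⊢
    exact ⟨Finset.mem_univ _, (add_comm _ _).trans hp.2⟩
  · intro p _
    exact Prod.swap_swap p

variable {f}

/-- Equal sums `x + y = z + w` correspond to equal differences `x - z = w - y`, which are counted
by the relative difference set property. -/
theorem IsPseudoPlanar.sum_rep_sq (hf : IsPseudoPlanar f) :
    ∑ r, (rep f r : ℤ) ^ 2 = 2 * (2 ^ n * 2 ^ n) - 2 ^ n := by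
  classical
  have h1 : ∀ x z : Teich h, (∑ y : Teich h, ∑ w : Teich h,
      if point f z + point f w = point f x + point f y then (1 : ℤ) else 0) =
      1 + if x = z then 2 ^ n - 1 else 0 := by
    intro x z
    by_cases hxz : x = z
    · subst hxz
      simp [(point_injective f).eq_iff, Teich.card_eq]
    · have hr : res (point f x - point f z) ≠ 0 := by
        rw [map_sub, res_point, res_point, sub_ne_zero]
        exact fun h => hxz (Teich.res_inj.1 h)
      obtain ⟨⟨w₀, y₀⟩, hp, huniq⟩ := hf.existsUnique_sub hr
      rw [Finset.sum_eq_single y₀, Finset.sum_eq_single w₀]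
      · rw [if_pos, if_neg hxz, add_zero]
        linear_combination hp
      · intro w _ hw
        refine if_neg fun h => hw ?_
        exact congrArg Prod.fst (huniq (w, y₀) (by linear_combination h))
      · simp
      · intro y _ hy
        refine Finset.sum_eq_zero fun w _ => if_neg fun h => hy ?_
        exact congrArg Prod.snd (huniq (w, y) (by linear_combination h))
      · simp
  have h2 : ∀ r, (rep f r : ℤ) = ∑ x, ∑ y, if point f x + point f y = r then (1 : ℤ) else 0 := by
    intro r
    rw [rep_eq_sum, Fintype.sum_prod_type]
    push_cast
    rfl
  have h3 : ∑ r, (rep f r : ℤ) ^ 2 = ∑ x, ∑ y, (rep f (point f x + point f y) : ℤ) := by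
    have h4 : ∀ r, (rep f r : ℤ) ^ 2 = ∑ x, ∑ y,
        if point f x + point f y = r then (rep f r : ℤ) else 0 := by
      intro r
      rw [pow_two]
      conv_lhs => rw [h2 r]
      rw [Finset.sum_mul]
      refine Finset.sum_congr rfl fun x _ => ?_
      rw [Finset.sum_mul]
      refine Finset.sum_congr rfl fun y _ => ?_
      rw [← h2, ite_mul, one_mul, zero_mul]
    simp only [h4]
    rw [Finset.sum_comm]
    refine Finset.sum_congr rfl fun x _ => ?_
    rw [Finset.sum_comm]
    refine Finset.sum_congr rfl fun y _ => ?_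
    simp
  rw [h3]
  simp only [h2]
  have h5 : ∀ x, ∑ y, ∑ z, ∑ w, (if point f z + point f w = point f x + point f y then (1 : ℤ)
      else 0) = ∑ z, (1 + if x = z then 2 ^ n - 1 else 0) := by
    intro x
    rw [Finset.sum_comm]
    exact Finset.sum_congr rfl fun z _ => h1 x z
  simp only [h5]
  simp [Finset.sum_add_distrib, Teich.card_eq]
  ring

theorem card_filter_zeroDivs [DecidablePred (· ∈ zeroDivs h)] :
    (Finset.univ.filter (· ∈ zeroDivs h)).card = 2 ^ n := by
  classical
  have : Finset.univ.filter (· ∈ zeroDivs h) = Finset.univ.image (Teich.twoSqrt (h := h)) := by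
    ext r
    simp [zeroDivs_eq_range]
  rw [this, Finset.card_image_of_injective _ Teich.twoSqrt_injective, Finset.card_univ,
    Teich.card_eq]

/-- The first two moments of `rep` and its parity leave only the values `0` and `2` outside `2R`. -/
theorem IsPseudoPlanar.rep_eq (hf : IsPseudoPlanar f) {r : GR4 h} (hr : r ∉ zeroDivs h) :
    rep f r = 0 ∨ rep f r = 2 := by
  classical
  -- Off `2R` the term is `rep * (rep - 2)` with `rep` even, on `2R` it is `1 - 2 + 1`. So it is
  -- nonnegative, and by the moments the sum of all terms is zero.
  have hnonneg : ∀ r ∈ Finset.univ, 0 ≤ (rep f r : ℤ) ^ 2 - 2 * rep f r +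
      if r ∈ zeroDivs h then 1 else 0 := by
    intro r _
    by_cases hr : r ∈ zeroDivs h
    · simp [hr, rep_of_mem_zeroDivs f hr]
    · obtain ⟨k, hk⟩ := even_rep f hr
      rw [if_neg hr, hk]
      push_cast
      rcases Nat.eq_zero_or_pos k with rfl | hk
      · simp
      · have : (1 : ℤ) ≤ k := by exact_mod_cast hk
        nlinarith
  have hsum : ∑ r, ((rep f r : ℤ) ^ 2 - 2 * rep f r + if r ∈ zeroDivs h then 1 else 0) = 0 := by
    have h1 : ∑ r, (rep f r : ℤ) = 2 ^ n * 2 ^ n := by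
      have := sum_rep f
      exact_mod_cast this
    rw [Finset.sum_add_distrib, Finset.sum_sub_distrib, hf.sum_rep_sq, ← Finset.mul_sum, h1,
      Finset.sum_boole, card_filter_zeroDivs]
    push_cast
    ring
  have h2 := (Finset.sum_eq_zero_iff_of_nonneg hnonneg).1 hsum r (Finset.mem_univ r)
  rw [if_neg hr, add_zero, pow_two, ← sub_mul, mul_eq_zero] at h2
  omega

/-! ### Character values of the relative difference set -/

variable (f) in
/-- The character value `χ(D_f)`. -/
noncomputable def pointSum (χ : AddChar (GR4 h) ℂ) : ℂ := ∑ x, χ (point f x)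

theorem charSum_range {G α : Type*} [AddCommGroup G] [Fintype α] (χ : AddChar G ℂ) {g : α → G}
    (hg : Function.Injective g) : charSum χ (Set.range g) = ∑ x, χ (g x) := by
  rw [charSum, finsum_mem_range hg, finsum_eq_sum_of_fintype]

theorem charSum_diffSet (χ : AddChar (GR4 h) ℂ) : charSum χ (diffSet f) = pointSum f χ := by
  rw [diffSet_eq_range, charSum_range χ (point_injective f), pointSum]

theorem charSum_zeroDivs (χ : AddChar (GR4 h) ℂ) :
    charSum χ (zeroDivs h) = ∑ c : Teich h, χ (Teich.twoSqrt c) := by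
  rw [zeroDivs_eq_range, charSum_range χ Teich.twoSqrt_injective]

theorem sum_twoSqrt_of_trivial {χ : AddChar (GR4 h) ℂ} (hχ : ∀ z ∈ zeroDivs h, χ z = 1) :
    ∑ c : Teich h, χ (Teich.twoSqrt c) = 2 ^ n := by
  rw [Finset.sum_congr rfl fun c _ => hχ _ (Teich.mem_zeroDivs_iff_exists.2 ⟨c, rfl⟩)]
  simp [Teich.card_eq]

theorem Teich.sum_add_left {M : Type*} [AddCommMonoid M] (x : Teich h) (g : Teich h → M) :
    ∑ y, g (x + y) = ∑ y, g y :=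
  Equiv.sum_comp (Function.Involutive.toPerm (fun y => x + y) (Teich.add_add_cancel x)) g

theorem sum_twoSqrt_of_not_trivial {χ : AddChar (GR4 h) ℂ} (hχ : ¬ ∀ z ∈ zeroDivs h, χ z = 1) :
    ∑ c : Teich h, χ (Teich.twoSqrt c) = 0 := by
  push Not at hχ
  obtain ⟨_, hz, hne⟩ := hχ
  obtain ⟨d, rfl⟩ := Teich.mem_zeroDivs_iff_exists.1 hz
  have h1 := Teich.sum_add_left d fun c => χ (Teich.twoSqrt c)
  simp only [Teich.twoSqrt_add, AddChar.map_add_eq_mul, ← Finset.mul_sum] at h1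
  have h2 : (χ (Teich.twoSqrt d) - 1) * ∑ c : Teich h, χ (Teich.twoSqrt c) = 0 := by
    rw [sub_mul, h1, one_mul, sub_self]
  exact (mul_eq_zero.1 h2).resolve_left (sub_ne_zero.2 hne)

/-- `D_f` meets every coset of `2R` once. -/
theorem pointSum_of_trivial {χ : AddChar (GR4 h) ℂ} (h0 : χ ≠ 0)
    (hχ : ∀ z ∈ zeroDivs h, χ z = 1) : pointSum f χ = 0 := by
  classical
  have h1 : ∑ r, χ r = 0 := by rw [AddChar.sum_eq_ite, if_neg h0]
  rw [← Equiv.sum_comp (Equiv.ofBijective _ (Teich.val_add_twoSqrt_bijective (h := h))),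
    Fintype.sum_prod_type] at h1
  have h2 : ∀ c : Teich h, χ (Teich.twoSqrt c) = 1 := fun c =>
    hχ _ (Teich.mem_zeroDivs_iff_exists.2 ⟨c, rfl⟩)
  simp only [Equiv.ofBijective_apply, AddChar.map_add_eq_mul, h2, mul_one, Finset.sum_const,
    ← Finset.smul_sum, Finset.card_univ, Teich.card_eq] at h1
  simp only [pointSum, point, AddChar.map_add_eq_mul, h2, mul_one]
  simpa using h1

theorem pointSum_zero : pointSum f 0 = 2 ^ n := by
  simp [pointSum, Teich.card_eq]

/-- The relative difference set equation, evaluated at a character that is not trivial on `2R`. -/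
theorem IsPseudoPlanar.pointSum_mul_conj (hf : IsPseudoPlanar f) {χ : AddChar (GR4 h) ℂ}
    (hχ : ¬ ∀ z ∈ zeroDivs h, χ z = 1) :
    pointSum f χ * starRingEnd ℂ (pointSum f χ) = 2 ^ n := by
  have h1 : pointSum f χ * starRingEnd ℂ (pointSum f χ) =
      ∑ x, ∑ ε, χ (point f (x + ε) - point f x) := by
    rw [pointSum, map_sum, Finset.mul_sum]
    refine Finset.sum_congr rfl fun x _ => ?_
    rw [Teich.sum_add_left x fun y => χ (point f y - point f x), Finset.sum_mul]
    refine Finset.sum_congr rfl fun y _ => ?_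
    rw [sub_eq_add_neg, AddChar.map_add_eq_mul, AddChar.map_neg_eq_conj]
  rw [h1, Finset.sum_comm, Finset.sum_eq_single 0]
  · simp [Teich.add_zero, Teich.card_eq]
  · intro ε _ hε
    simp only [point_add_sub, AddChar.map_add_eq_mul (ψ := χ), ← Finset.mul_sum]
    have h2 := Equiv.sum_comp (Equiv.ofBijective _ (hf ε hε)) fun c => χ (Teich.twoSqrt c)
    simp only [Equiv.ofBijective_apply] at h2
    rw [h2, sum_twoSqrt_of_not_trivial hχ, mul_zero]
  · simp

variable (f) in
/-- Sums of two elements of `D_f` are counted by the convolution square of its indicator. -/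
theorem charCoeff_rep (χ : AddChar (GR4 h) ℂ) :
    charCoeff χ (fun r => (rep f r : ℂ)) = pointSum f χ ^ 2 := by
  classical
  simp only [charCoeff_apply, rep_eq_sum, Nat.cast_sum, Finset.sum_mul]
  rw [Finset.sum_comm, pow_two, pointSum, Finset.sum_mul_sum, Fintype.sum_prod_type]
  refine Finset.sum_congr rfl fun x _ => Finset.sum_congr rfl fun y _ => ?_
  simp [AddChar.map_add_eq_mul]

theorem eq_of_pow_four_eq_one {z : ℂ} (hz : z ^ 4 = 1) :
    z = 1 ∨ z = -1 ∨ z = Complex.I ∨ z = -Complex.I := by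
  have h1 : (z - 1) * ((z + 1) * ((z - Complex.I) * (z + Complex.I))) = 0 := by
    linear_combination hz - (z ^ 2 - 1) * Complex.I_sq
  simpa [sub_eq_zero, add_eq_zero_iff_eq_neg] using h1

variable (f) in
/-- The characters of `R` take values in the fourth roots of unity, so that character sums are
Gaussian integers. -/
theorem exists_pointSum_eq (χ : AddChar (GR4 h) ℂ) :
    ∃ a b : ℤ, pointSum f χ = a + b * Complex.I := by
  have h1 : pointSum f χ ∈ GaussianInt.toComplex.range := by
    refine sum_mem fun x _ => ?_
    have h4 : χ (point f x) ^ 4 = 1 := by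
      rw [← AddChar.map_nsmul_eq_pow, nsmul_eq_mul]
      push_cast
      rw [Teich.four_eq_zero, zero_mul, AddChar.map_zero_eq_one]
    have hI : Complex.I ∈ GaussianInt.toComplex.range :=
      ⟨⟨0, 1⟩, by simp [GaussianInt.toComplex_def]⟩
    rcases eq_of_pow_four_eq_one h4 with h | h | h | h <;> rw [h]
    · exact one_mem _
    · exact neg_mem (one_mem _)
    · exact hI
    · exact neg_mem hI
  obtain ⟨z, hz⟩ := h1
  exact ⟨z.re, z.im, by rw [← hz, GaussianInt.toComplex_def]⟩

theorem even_of_sq_add_sq {a b c : ℤ} (hab : a ^ 2 + b ^ 2 = 4 * c) : Even a ∧ Even b := by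
  rcases Int.even_or_odd' a with ⟨k, rfl | rfl⟩ <;> rcases Int.even_or_odd' b with ⟨l, rfl | rfl⟩
  · simp
  all_goals
    exfalso
    ring_nf at hab
    omega

/-- An even power of `2` is a sum of two squares only in the trivial way. -/
theorem sq_add_sq_eq_four_pow (m : ℕ) {a b : ℤ} (hab : a ^ 2 + b ^ 2 = 4 ^ m) :
    ((a = 2 ^ m ∨ a = -2 ^ m) ∧ b = 0) ∨ (a = 0 ∧ (b = 2 ^ m ∨ b = -2 ^ m)) := by
  induction m generalizing a b with
  | zero =>
    have ha : a ≤ 1 ∧ -1 ≤ a := by constructor <;> nlinarith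
    have hb : b ≤ 1 ∧ -1 ≤ b := by constructor <;> nlinarith
    obtain ⟨ha1, ha2⟩ := ha
    obtain ⟨hb1, hb2⟩ := hb
    interval_cases a <;> interval_cases b <;> simp_all
  | succ m ih =>
    obtain ⟨⟨a, rfl⟩, ⟨b, rfl⟩⟩ := even_of_sq_add_sq (c := 4 ^ m) (by rw [hab]; ring)
    have := ih (a := a) (b := b) (by linarith [pow_succ (4 : ℤ) m])
    rw [pow_succ]
    omega

/-- An odd power of `2` is a sum of two squares only with equal squares. -/
theorem sq_add_sq_eq_two_mul_four_pow (m : ℕ) {a b : ℤ} (hab : a ^ 2 + b ^ 2 = 2 * 4 ^ m) :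
    (a = 2 ^ m ∨ a = -2 ^ m) ∧ (b = 2 ^ m ∨ b = -2 ^ m) := by
  induction m generalizing a b with
  | zero =>
    have ha : a ≤ 1 ∧ -1 ≤ a := by constructor <;> nlinarith
    have hb : b ≤ 1 ∧ -1 ≤ b := by constructor <;> nlinarith
    obtain ⟨ha1, ha2⟩ := ha
    obtain ⟨hb1, hb2⟩ := hb
    interval_cases a <;> interval_cases b <;> simp_all
  | succ m ih =>
    obtain ⟨⟨a, rfl⟩, ⟨b, rfl⟩⟩ := even_of_sq_add_sq (c := 2 * 4 ^ m) (by rw [hab]; ring)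
    have := ih (a := a) (b := b) (by linarith [pow_succ (4 : ℤ) m])
    rw [pow_succ]
    omega

theorem IsPseudoPlanar.exists_pointSum_eq (hf : IsPseudoPlanar f) {χ : AddChar (GR4 h) ℂ}
    (hχ : ¬ ∀ z ∈ zeroDivs h, χ z = 1) :
    ∃ a b : ℤ, pointSum f χ = a + b * Complex.I ∧ a ^ 2 + b ^ 2 = 2 ^ n := by
  obtain ⟨a, b, hab⟩ := _root_.exists_pointSum_eq f χ
  refine ⟨a, b, hab, ?_⟩
  have h1 := hf.pointSum_mul_conj hχ
  rw [hab] at h1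
  simp only [map_add, map_mul, Complex.conj_I, map_intCast] at h1
  have h2 : ((a ^ 2 + b ^ 2 : ℤ) : ℂ) = (2 ^ n : ℤ) := by
    push_cast
    linear_combination h1 + b ^ 2 * Complex.I_sq
  exact_mod_cast h2

theorem IsPseudoPlanar.pointSum_of_odd (hf : IsPseudoPlanar f) (hn : Odd n)
    {χ : AddChar (GR4 h) ℂ} (hχ : ¬ ∀ z ∈ zeroDivs h, χ z = 1) {B : ℂ}
    (hB : B = 2 ^ ((n - 1) / 2)) :
    pointSum f χ = B + B * Complex.I ∨ pointSum f χ = B - B * Complex.I ∨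
      pointSum f χ = -B + B * Complex.I ∨ pointSum f χ = -B - B * Complex.I := by
  obtain ⟨a, b, hab, hsq⟩ := hf.exists_pointSum_eq hχ
  have hn' : (2 : ℤ) ^ n = 2 * 4 ^ ((n - 1) / 2) := by
    obtain ⟨m, hm⟩ := hn
    have : (n - 1) / 2 = m := by omega
    rw [this, hm, pow_succ, pow_mul]
    ring
  rw [hn'] at hsq
  rw [hab, hB]
  obtain ⟨rfl | rfl, rfl | rfl⟩ := sq_add_sq_eq_two_mul_four_pow _ hsq <;> push_cast
  · simp
  · right; left; ring
  · right; right; left; ring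
  · right; right; right; ring

theorem IsPseudoPlanar.pointSum_of_even (hf : IsPseudoPlanar f) (hn : Even n)
    {χ : AddChar (GR4 h) ℂ} (hχ : ¬ ∀ z ∈ zeroDivs h, χ z = 1) {B : ℂ}
    (hB : B = 2 ^ (n / 2)) :
    pointSum f χ = B ∨ pointSum f χ = -B ∨
      pointSum f χ = B * Complex.I ∨ pointSum f χ = -(B * Complex.I) := by
  obtain ⟨a, b, hab, hsq⟩ := hf.exists_pointSum_eq hχ
  have hn' : (2 : ℤ) ^ n = 4 ^ (n / 2) := by
    obtain ⟨m, hm⟩ := hn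
    have : n / 2 = m := by omega
    rw [this, hm, ← two_mul, pow_mul]
    norm_num
  rw [hn'] at hsq
  rw [hab, hB]
  obtain ⟨rfl | rfl, rfl⟩ | ⟨rfl, rfl | rfl⟩ := sq_add_sq_eq_four_pow _ hsq <;> push_cast <;> simp

end DifferenceSet

/-! ### Arithmetic of the eigenmatrices -/

section EigenmatrixArithmetic

open Complex

theorem one_sub_mul_I_ne_zero (β : ℝ) : (1 - β * I : ℂ) ≠ 0 := by
  intro h
  have := congrArg Complex.re h
  simp at this

/-- The entry of `Q` that is written as a fraction is the conjugate of its neighbour. -/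
theorem oddQ_last (β : ℝ) :
    (β : ℂ) * (β ^ 2 + 1) / (2 * (1 - β * I)) = β / 2 * (1 + β * I) := by
  rw [div_eq_iff (mul_ne_zero two_ne_zero (one_sub_mul_I_ne_zero β))]
  linear_combination (β : ℂ) ^ 3 * I_sq

theorem oddP_mul_oddQ (β : ℝ) :
    oddP β * oddQ β = (2 * (β : ℂ) ^ 2) ^ 2 • (1 : Matrix (Fin 6) (Fin 6) ℂ) := by
  have hI := I_sq
  ext i j
  fin_cases i <;> fin_cases j <;>
    simp [oddP, oddQ, Matrix.mul_apply, Fin.sum_univ_succ, oddQ_last] <;> grind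

theorem evenP_mul_evenQ (b : ℂ) :
    evenP b * evenQ b = (4 * b ^ 2) ^ 2 • (1 : Matrix (Fin 6) (Fin 6) ℂ) := by
  have hI := I_sq
  ext i j
  fin_cases i <;> fin_cases j <;>
    simp [evenP, evenQ, Matrix.mul_apply, Fin.sum_univ_succ] <;> grind

theorem conj_oddP (β : ℝ) (l i : Fin 6) :
    starRingEnd ℂ (oddP β l i) = oddP β l (![0, 2, 1, 3, 5, 4] i) := by
  fin_cases l <;> fin_cases i <;>
    simp [oddP, map_ofNat, -mul_eq_mul_left_iff, -mul_eq_mul_right_iff] <;> ring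

theorem conj_evenP (β : ℝ) (l i : Fin 6) :
    starRingEnd ℂ (evenP β l i) = evenP β l (![0, 2, 1, 3, 4, 5] i) := by
  fin_cases l <;> fin_cases i <;>
    simp [evenP, map_ofNat, -mul_eq_mul_left_iff, -mul_eq_mul_right_iff] <;> ring

theorem conj_oddQ (β : ℝ) (l i : Fin 6) :
    starRingEnd ℂ (oddQ β l i) = oddQ β l (![0, 1, 3, 2, 5, 4] i) := by
  fin_cases l <;> fin_cases i <;>
    simp [oddQ, oddQ_last, map_ofNat, -mul_eq_mul_left_iff, -mul_eq_mul_right_iff] <;> ring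

theorem conj_evenQ (β : ℝ) (l i : Fin 6) :
    starRingEnd ℂ (evenQ β l i) = evenQ β l (![0, 1, 2, 3, 5, 4] i) := by
  fin_cases l <;> fin_cases i <;>
    simp [evenQ, map_ofNat, -mul_eq_mul_left_iff, -mul_eq_mul_right_iff] <;> ring

theorem oddP_column_injective {β : ℝ} (hβ : 1 ≤ β) {i j : Fin 6} (hij : oddP β i 1 = oddP β j 1) :
    i = j := by
  have hre := congrArg Complex.re hij
  have him := congrArg Complex.im hij
  fin_cases i <;> fin_cases j <;> first
    | rfl
    | (exfalso; simp [oddP, ← ofReal_pow] at hre him; nlinarith)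

theorem evenP_column_injective {β : ℝ} (hβ : 1 ≤ β) {i j : Fin 6}
    (hij : evenP β i 1 = evenP β j 1) : i = j := by
  have hre := congrArg Complex.re hij
  have him := congrArg Complex.im hij
  fin_cases i <;> fin_cases j <;> first
    | rfl
    | (exfalso; simp [evenP, ← ofReal_pow] at hre him; nlinarith)

theorem oddP_zero_ne_zero {β : ℝ} (hβ : 2 ≤ β) (i : Fin 6) : oddP β 0 i ≠ 0 := by
  intro h
  have hre := congrArg Complex.re h
  have h4 : β ^ 4 = (β ^ 2) ^ 2 := by ring
  have h2 : 4 ≤ β ^ 2 := by nlinarith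
  fin_cases i <;> simp [oddP, ← ofReal_pow] at hre <;> nlinarith

theorem evenP_zero_ne_zero {β : ℝ} (hβ : 2 ≤ β) (i : Fin 6) : evenP β 0 i ≠ 0 := by
  intro h
  have hre := congrArg Complex.re h
  have h4 : β ^ 4 = (β ^ 2) ^ 2 := by ring
  have h2 : 4 ≤ β ^ 2 := by nlinarith
  fin_cases i <;> simp [evenP, ← ofReal_pow] at hre <;> nlinarith

theorem eigenP_of_odd {n : ℕ} (hn : Odd n) :
    eigenP n = oddP ((2 ^ ((n - 1) / 2) : ℝ) : ℂ) := by
  simp [eigenP, hn]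

theorem eigenP_of_even {n : ℕ} (hn : ¬ Odd n) :
    eigenP n = evenP ((2 ^ ((n - 2) / 2) : ℝ) : ℂ) := by
  simp only [eigenP, if_neg hn]
  push_cast
  rfl

theorem eigenQ_of_odd {n : ℕ} (hn : Odd n) :
    eigenQ n = oddQ ((2 ^ ((n - 1) / 2) : ℝ) : ℂ) := by
  simp [eigenQ, hn]

theorem eigenQ_of_even {n : ℕ} (hn : ¬ Odd n) :
    eigenQ n = evenQ ((2 ^ ((n - 2) / 2) : ℝ) : ℂ) := by
  simp only [eigenQ, if_neg hn]
  push_cast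
  rfl

theorem two_pow_of_odd {n : ℕ} (hn : Odd n) :
    (2 : ℂ) ^ n = 2 * ((2 ^ ((n - 1) / 2) : ℝ) : ℂ) ^ 2 := by
  obtain ⟨m, rfl⟩ := hn
  have : (2 * m + 1 - 1) / 2 = m := by omega
  rw [this]
  push_cast
  ring

theorem two_pow_of_even {n : ℕ} (hn : ¬ Odd n) (h0 : n ≠ 0) :
    (2 : ℂ) ^ n = 4 * ((2 ^ ((n - 2) / 2) : ℝ) : ℂ) ^ 2 := by
  obtain ⟨m, rfl⟩ := Nat.not_odd_iff_even.1 hn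
  obtain ⟨k, rfl⟩ := Nat.exists_eq_succ_of_ne_zero (show m ≠ 0 by omega)
  have h1 : (k.succ + k.succ - 2) / 2 = k := by omega
  have h2 : k.succ + k.succ = 2 * k + 2 := by omega
  rw [h1, h2]
  push_cast
  ring

theorem eigenP_mul_eigenQ {n : ℕ} (h0 : n ≠ 0) :
    eigenP n * eigenQ n = ((2 : ℂ) ^ n * 2 ^ n) • (1 : Matrix (Fin 6) (Fin 6) ℂ) := by
  by_cases hn : Odd n
  · rw [eigenP_of_odd hn, eigenQ_of_odd hn, oddP_mul_oddQ, two_pow_of_odd hn, pow_two]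
  · rw [eigenP_of_even hn, eigenQ_of_even hn, evenP_mul_evenQ, two_pow_of_even hn h0, pow_two]

theorem exists_conj_eigenP (n : ℕ) :
    ∃ σ : Fin 6 → Fin 6, ∀ l i, starRingEnd ℂ (eigenP n l i) = eigenP n l (σ i) := by
  by_cases hn : Odd n
  · exact ⟨_, by rw [eigenP_of_odd hn]; exact conj_oddP _⟩
  · exact ⟨_, by rw [eigenP_of_even hn]; exact conj_evenP _⟩

theorem exists_conj_eigenQ (n : ℕ) :
    ∃ σ : Fin 6 → Fin 6, ∀ l i, starRingEnd ℂ (eigenQ n l i) = eigenQ n l (σ i) := by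
  by_cases hn : Odd n
  · exact ⟨_, by rw [eigenQ_of_odd hn]; exact conj_oddQ _⟩
  · exact ⟨_, by rw [eigenQ_of_even hn]; exact conj_evenQ _⟩

/-- The value on `S₁` determines the row. -/
theorem eigenP_column_injective {n : ℕ} {i j : Fin 6} (hij : eigenP n i 1 = eigenP n j 1) :
    i = j := by
  by_cases hn : Odd n
  · rw [eigenP_of_odd hn] at hij
    exact oddP_column_injective (one_le_pow₀ one_le_two) hij
  · rw [eigenP_of_even hn] at hij
    exact evenP_column_injective (one_le_pow₀ one_le_two) hij

/-- For `n ≥ 3` no class is empty, the entries of the row of the principal character being the sizes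
of the classes. The bound is sharp: the entries vanish at `b = 1` in the last two columns for odd `n`,
and in the fifth column for even `n`. -/
theorem eigenP_zero_ne_zero {n : ℕ} (h3 : 3 ≤ n) (i : Fin 6) : eigenP n 0 i ≠ 0 := by
  have key : ∀ {k : ℕ}, k ≠ 0 → (2 : ℝ) ≤ 2 ^ k := fun hk => le_self_pow₀ one_le_two hk
  by_cases hn : Odd n
  · rw [eigenP_of_odd hn]
    exact oddP_zero_ne_zero (key (by omega)) i
  · rw [eigenP_of_even hn]
    rw [Nat.not_odd_iff_even] at hn
    obtain ⟨m, rfl⟩ := hn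
    exact evenP_zero_ne_zero (key (by omega)) i

end EigenmatrixArithmetic

/-! ### The partition and its character values -/

section Partition

variable {n : ℕ} {h : BasicIrreducible n} {f : Teich h → Teich h}

/-- For odd `n` the values `χ(D_f) ^ 2` at nonprincipal characters are purely imaginary, and so the
even part of `rep` is constant. -/
theorem IsPseudoPlanar.rep_add_rep_neg (hf : IsPseudoPlanar f) (hn : Odd n) (r : GR4 h) :
    rep f r + rep f (-r) = 2 := by
  classical
  have key : (fun r => (rep f r : ℂ)) + (fun r => (rep f (-r) : ℂ)) - (fun _ => (2 : ℂ)) = 0 := by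
    refine isSeparating_id _ fun χ => ?_
    simp only [id]
    rw [map_sub, map_add, charCoeff_comp_neg χ (u := fun r => (rep f r : ℂ)) (fun r => by simp),
      charCoeff_rep, charCoeff_apply, ← Finset.mul_sum, AddChar.sum_eq_ite]
    by_cases h0 : χ = 0
    · subst h0
      rw [if_pos rfl, pointSum_zero, GR4.card]
      simp only [map_pow, map_ofNat]
      push_cast
      ring
    · rw [if_neg h0]
      by_cases hχ : ∀ z ∈ zeroDivs h, χ z = 1
      · rw [pointSum_of_trivial h0 hχ]
        simp
      · have hB : starRingEnd ℂ ((2 : ℂ) ^ ((n - 1) / 2)) = 2 ^ ((n - 1) / 2) := by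
          simp [map_ofNat]
        rcases hf.pointSum_of_odd hn hχ rfl with h | h | h | h <;> rw [h] <;>
          simp only [map_pow _ _ 2, map_add, map_sub, map_neg, map_mul, Complex.conj_I, hB] <;>
          ring_nf <;> simp
  have h1 := congrFun key r
  simp only [Pi.sub_apply, Pi.add_apply, Pi.zero_apply, sub_eq_zero] at h1
  exact_mod_cast h1

/-- For even `n` all values `χ(D_f) ^ 2` are real. -/
theorem IsPseudoPlanar.rep_neg (hf : IsPseudoPlanar f) (hn : ¬ Odd n) (r : GR4 h) :
    rep f (-r) = rep f r := by
  classical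
  rw [Nat.not_odd_iff_even] at hn
  have key : (fun r => (rep f (-r) : ℂ)) - (fun r => (rep f r : ℂ)) = 0 := by
    refine isSeparating_id _ fun χ => ?_
    simp only [id]
    rw [map_sub, charCoeff_comp_neg χ (u := fun r => (rep f r : ℂ)) (fun r => by simp),
      charCoeff_rep]
    by_cases h0 : χ = 0
    · subst h0
      rw [pointSum_zero]
      simp [map_ofNat]
    · by_cases hχ : ∀ z ∈ zeroDivs h, χ z = 1
      · rw [pointSum_of_trivial h0 hχ]
        simp
      · have hB : starRingEnd ℂ ((2 : ℂ) ^ (n / 2)) = 2 ^ (n / 2) := by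
          simp [map_ofNat]
        rcases hf.pointSum_of_even hn hχ rfl with h | h | h | h <;> rw [h] <;>
          simp only [map_pow _ _ 2, map_neg, map_mul, Complex.conj_I, hB] <;> ring
  have h1 := congrFun key r
  simp only [Pi.sub_apply, Pi.zero_apply, sub_eq_zero] at h1
  exact_mod_cast h1

variable (f) in
theorem point_mem_zeroDivs_iff {x : Teich h} : point f x ∈ zeroDivs h ↔ x = 0 := by
  rw [mem_zeroDivs_iff, res_point, ← Teich.res_inj, Teich.val_zero, map_zero]

theorem point_zero (hf0 : f 0 = 0) : point f 0 = 0 := by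
  rw [point, hf0, Teich.val_zero, Teich.twoSqrt_zero, add_zero]

theorem not_mem_zeroDivs_of_mem_diffSet (hf0 : f 0 = 0) {r : GR4 h} (hr : r ∈ diffSet f \ {0}) :
    r ∉ zeroDivs h := by
  obtain ⟨hr1, hr0⟩ := hr
  rw [diffSet_eq_range] at hr1
  obtain ⟨x, rfl⟩ := hr1
  rw [point_mem_zeroDivs_iff]
  rintro rfl
  exact hr0 (point_zero hf0)

theorem neg_mem_zeroDivs_iff {r : GR4 h} : -r ∈ zeroDivs h ↔ r ∈ zeroDivs h := by
  rw [mem_zeroDivs_iff, mem_zeroDivs_iff, map_neg, neg_eq_zero]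

theorem zero_mem_zeroDivs : (0 : GR4 h) ∈ zeroDivs h := mem_zeroDivs_iff.2 (map_zero _)

/-- The sets `S₁` and `S₂` are disjoint: `0` is a sum of two elements of `D_f` only as `0 + 0`. -/
theorem neg_not_mem_diffSet (hf0 : f 0 = 0) {r : GR4 h} (hr : r ∈ diffSet f \ {0}) :
    -r ∉ diffSet f \ {0} := by
  intro hr'
  have hZ := not_mem_zeroDivs_of_mem_diffSet hf0 hr
  obtain ⟨hr1, -⟩ := hr
  obtain ⟨hr2, -⟩ := hr'
  rw [diffSet_eq_range] at hr1 hr2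
  obtain ⟨x, rfl⟩ := hr1
  obtain ⟨y, hy⟩ := hr2
  have hsum : point f x + point f y = 0 := by rw [hy, add_neg_cancel]
  obtain rfl : x = y := eq_of_point_add_mem f (hsum ▸ zero_mem_zeroDivs)
  rw [point_add_self] at hsum
  have hx : x = 0 := by
    refine Teich.mul_self_injective (Teich.twoSqrt_injective ?_)
    rw [hsum, ← point_add_self (fun _ => 0)]
    simp [point]
  exact hZ ((point_mem_zeroDivs_iff f).2 hx)

theorem exists_mem_schurClass (f : Teich h → Teich h) (x : GR4 h) : ∃ i, x ∈ schurClass f i := by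
  by_cases h0 : x = 0
  · exact ⟨0, h0⟩
  by_cases h1 : x ∈ diffSet f \ {0}
  · exact ⟨1, h1⟩
  by_cases h2 : -x ∈ diffSet f \ {0}
  · exact ⟨2, h2⟩
  by_cases h3 : x ∈ zeroDivs h \ {0}
  · exact ⟨3, h3⟩
  by_cases h4 : x ∈ sumsOfTwo f
  · exact ⟨4, ⟨h0, h1, h2, h3⟩, h4⟩
  · exact ⟨5, ⟨h0, h1, h2, h3⟩, h4⟩

theorem eq_of_mem_schurClass (hf0 : f 0 = 0) (x : GR4 h) (i j : Fin 6)
    (hi : x ∈ schurClass f i) (hj : x ∈ schurClass f j) : i = j := by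
  have key : ∀ i j : Fin 6, i < j → x ∈ schurClass f i → x ∉ schurClass f j := by
    have h1 : x ∈ diffSet f \ {0} → -x ∉ diffSet f \ {0} := neg_not_mem_diffSet hf0
    have h2 : x ∈ diffSet f \ {0} → x ∉ zeroDivs h := not_mem_zeroDivs_of_mem_diffSet hf0
    have h3 : -x ∈ diffSet f \ {0} → x ∉ zeroDivs h := fun hx =>
      neg_mem_zeroDivs_iff.not.1 (not_mem_zeroDivs_of_mem_diffSet hf0 hx)
    intro i j hij hi hj
    have h5 : ∀ {s : Set (GR4 h)}, x ∈ remaining f ∩ s → x ∈ remaining f := fun hx => hx.1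
    have h6 : ∀ {s : Set (GR4 h)}, x ∈ remaining f \ s → x ∈ remaining f := fun hx => hx.1
    fin_cases i <;> fin_cases j <;> first
      | exact absurd hij (by decide)
      | exact hj.2 hi
      | (obtain rfl : x = 0 := hi
         first
           | exact hj.2 rfl
           | exact hj.2 neg_zero
           | exact hj.1.1 rfl)
      | exact h1 hi hj
      | exact h2 hi hj.1
      | exact h3 hi hj.1
      | exact hj.1.2.1 hi
      | exact hj.1.2.2.1 hi
      | exact hj.1.2.2.2 hi
      | exact hj.2 hi.2
  rcases lt_trichotomy i j with hij | hij | hij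
  · exact absurd hj (key i j hij hi)
  · exact hij
  · exact absurd hi (key j i hij hj)

/-- The number of representations is constant on the classes. In particular `S₄` is the part of the
support of `rep` outside `S₁`, `2R` and, for even `n`, `S₂`. -/
theorem IsPseudoPlanar.rep_of_mem_schurClass (hf : IsPseudoPlanar f) (hf0 : f 0 = 0) (i : Fin 6)
    {x : GR4 h} (hx : x ∈ schurClass f i) :
    rep f x = if Odd n then ![1, 2, 0, 1, 2, 0] i else ![1, 2, 2, 1, 2, 0] i := by
  have hD : ∀ {y : GR4 h}, y ∈ diffSet f \ {0} → rep f y = 2 := by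
    intro y hy
    -- `y = y + 0` is a representation because `0 ∈ D_f`.
    have hpos : 0 < rep f y := (rep_pos_iff f y).2
      ⟨y, hy.1, 0, by rw [diffSet_eq_range]; exact ⟨0, point_zero hf0⟩, (add_zero y).symm⟩
    have := hf.rep_eq (not_mem_zeroDivs_of_mem_diffSet hf0 hy)
    omega
  have hrem : x ∈ remaining f → x ∉ zeroDivs h := fun hx hz => hx.2.2.2 ⟨hz, hx.1⟩
  fin_cases i
  · obtain rfl : x = 0 := hx
    simp [rep_of_mem_zeroDivs f zero_mem_zeroDivs]
  · simp [hD hx]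
  · have h2 := hD hx
    by_cases hn : Odd n
    · have := hf.rep_add_rep_neg hn x
      simp [hn]
      omega
    · rw [hf.rep_neg hn] at h2
      simp [hn, h2]
  · simp [rep_of_mem_zeroDivs f hx.1]
  · have := hf.rep_eq (hrem hx.1)
    have := (rep_pos_iff f x).2 hx.2
    simp
    omega
  · have := (rep_pos_iff f x).not.2 hx.2
    simp
    omega

/-- The values of a character on all classes, in terms of its values on `D_f`, `2R` and `R`. -/
theorem IsPseudoPlanar.charSum_schurClass (hf : IsPseudoPlanar f) (hf0 : f 0 = 0)
    (χ : AddChar (GR4 h) ℂ) {d d' z w : ℂ} (hd : pointSum f χ = d)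
    (hd' : starRingEnd ℂ d = d') (hz : ∑ c : Teich h, χ (Teich.twoSqrt c) = z)
    (hw : ∑ x, χ x = w) (i : Fin 6) :
    charSum χ (schurClass f i) =
      if Odd n then ![1, d - 1, d' - 1, z - 1, (d ^ 2 - z) / 2 - (d - 1),
        w - (d ^ 2 + z) / 2 - (d' - 1)] i
      else ![1, d - 1, d' - 1, z - 1, (d ^ 2 - z) / 2 - (d - 1) - (d' - 1),
        w - (d ^ 2 + z) / 2] i := by
  classical
  have hS := eq_of_mem_schurClass hf0
  have hc := exists_mem_schurClass f
  have e0 : charSum χ (schurClass f 0) = 1 := by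
    simp [schurClass, charSum]
  have e2 : charSum χ (schurClass f 2) = starRingEnd ℂ (charSum χ (schurClass f 1)) :=
    charSum_neg_mem χ (schurClass f 1)
  have e1 : d = charSum χ (schurClass f 0) + charSum χ (schurClass f 1) := by
    rw [← hd, ← charSum_diffSet, ← charCoeff_ind,
      charCoeff_eq_sum hS hc χ (a := ![1, 1, 0, 0, 0, 0])]
    · simp [Fin.sum_univ_succ]
    · intro i x hx
      rw [ind_apply]
      have h1 : x ∈ diffSet f ↔ x ∈ schurClass f 0 ∨ x ∈ schurClass f 1 := by
        change _ ↔ x = 0 ∨ (x ∈ diffSet f ∧ x ≠ 0)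
        have h0 : x = 0 → x ∈ diffSet f := by
          rintro rfl
          rw [diffSet_eq_range]
          exact ⟨0, point_zero hf0⟩
        tauto
      have h2 : x ∈ diffSet f ↔ i = 0 ∨ i = 1 := by
        rw [h1]
        exact or_congr ⟨fun hx' => hS x _ _ hx hx', fun hi => hi ▸ hx⟩
          ⟨fun hx' => hS x _ _ hx hx', fun hi => hi ▸ hx⟩
      simp only [h2]
      fin_cases i <;> simp
  have e3 : z = charSum χ (schurClass f 0) + charSum χ (schurClass f 3) := by
    rw [← hz, ← charSum_zeroDivs, ← charCoeff_ind,
      charCoeff_eq_sum hS hc χ (a := ![1, 0, 0, 1, 0, 0])]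
    · simp [Fin.sum_univ_succ]
    · intro i x hx
      rw [ind_apply]
      have h1 : x ∈ zeroDivs h ↔ x ∈ schurClass f 0 ∨ x ∈ schurClass f 3 := by
        change _ ↔ x = 0 ∨ (x ∈ zeroDivs h ∧ x ≠ 0)
        have h0 : x = 0 → x ∈ zeroDivs h := by
          rintro rfl
          exact zero_mem_zeroDivs
        tauto
      have h2 : x ∈ zeroDivs h ↔ i = 0 ∨ i = 3 := by
        rw [h1]
        exact or_congr ⟨fun hx' => hS x _ _ hx hx', fun hi => hi ▸ hx⟩
          ⟨fun hx' => hS x _ _ hx hx', fun hi => hi ▸ hx⟩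
      simp only [h2]
      fin_cases i <;> simp
  have e5 : w = ∑ k, charSum χ (schurClass f k) := by
    have := charCoeff_eq_sum hS hc χ (u := fun _ => 1) (a := fun _ => 1) (fun _ _ _ => rfl)
    simpa [charCoeff_apply, hw] using this
  -- Transforming `rep` gives `χ(D_f) ^ 2` as a combination of the values on the classes, which is
  -- solved for the value on `S₄`.
  have e4 := charCoeff_eq_sum hS hc χ (u := fun r => (rep f r : ℂ))
    (a := fun i => ((if Odd n then ![1, 2, 0, 1, 2, 0] i else ![1, 2, 2, 1, 2, 0] i : ℕ) : ℂ))
    (fun i x hx => by rw [hf.rep_of_mem_schurClass hf0 i hx])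
  rw [charCoeff_rep, hd] at e4
  rw [e0] at e1 e3
  have e1' : charSum χ (schurClass f 1) = d - 1 := by rw [e1]; ring
  have e3' : charSum χ (schurClass f 3) = z - 1 := by rw [e3]; ring
  have e2' : charSum χ (schurClass f 2) = d' - 1 := by rw [e2, e1', map_sub, hd', map_one]
  simp only [Fin.sum_univ_six, e0, e1', e2', e3'] at e4 e5
  by_cases hn : Odd n
  · simp [hn] at e4 ⊢
    have e4' : charSum χ (schurClass f 4) = (d ^ 2 - z) / 2 - (d - 1) := by
      linear_combination -e4 / 2
    have e5' : charSum χ (schurClass f 5) = w - (d ^ 2 + z) / 2 - (d' - 1) := by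
      linear_combination -e5 - e4'
    fin_cases i
    exacts [e0, e1', e2', e3', e4', e5']
  · simp [hn] at e4 ⊢
    have e4' : charSum χ (schurClass f 4) = (d ^ 2 - z) / 2 - (d - 1) - (d' - 1) := by
      linear_combination -e4 / 2
    have e5' : charSum χ (schurClass f 5) = w - (d ^ 2 + z) / 2 := by
      linear_combination -e5 - e4'
    fin_cases i
    exacts [e0, e1', e2', e3', e4', e5']

end Partition

/-! ### The dual partition -/

section Dual

variable {n : ℕ} {h : BasicIrreducible n} {f : Teich h → Teich h}

theorem IsPseudoPlanar.charSum_one (hf : IsPseudoPlanar f) (hf0 : f 0 = 0)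
    (χ : AddChar (GR4 h) ℂ) : charSum χ (schurClass f 1) = pointSum f χ - 1 := by
  rw [hf.charSum_schurClass hf0 χ rfl rfl rfl rfl]
  simp

theorem sum_char_eq_zero {χ : AddChar (GR4 h) ℂ} (h0 : χ ≠ 0) : ∑ x, χ x = 0 := by
  classical
  rw [AddChar.sum_eq_ite, if_neg h0]

theorem sum_char_zero : ∑ x, (0 : AddChar (GR4 h) ℂ) x = 2 ^ n * 2 ^ n := by
  simp [GR4.card]

/-- For `j ≠ 0` the class `E j` is defined by the entry of `P` for `S₁`. -/
theorem mem_dualClass_iff {j : Fin 6} (hj : j ≠ 0) (χ : AddChar (GR4 h) ℂ) :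
    χ ∈ dualClass f j ↔ charSum χ (schurClass f 1) = eigenP n j 1 := by
  by_cases hn : Odd n
  · rw [eigenP_of_odd hn, dualClass, if_pos hn]
    fin_cases j
    · exact absurd rfl hj
    all_goals simp [charsWithValue, oddP]
  · have h2 : (2 : ℂ) ^ (n / 2) = 2 * 2 ^ ((n - 2) / 2) := by
      have h0 := degree_ne_zero h
      obtain ⟨m, rfl⟩ := Nat.not_odd_iff_even.1 hn
      rw [← pow_succ']
      congr 1
      omega
    rw [eigenP_of_even hn, dualClass, if_neg hn, h2]
    fin_cases j
    · exact absurd rfl hj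
    all_goals simp [charsWithValue, evenP]
    all_goals ring_nf

theorem dualClass_zero (f : Teich h → Teich h) : dualClass f 0 = {0} := by
  unfold dualClass
  split_ifs <;> rfl

theorem eigenP_row_zero {i : Fin 6} (h0 : n ≠ 0) : eigenP n 0 i =
    if Odd n then ![1, 2 ^ n - 1, 2 ^ n - 1, 2 ^ n - 1, ((2 ^ n) ^ 2 - 2 ^ n) / 2 - (2 ^ n - 1),
        2 ^ n * 2 ^ n - ((2 ^ n) ^ 2 + 2 ^ n) / 2 - (2 ^ n - 1)] i
      else ![1, 2 ^ n - 1, 2 ^ n - 1, 2 ^ n - 1,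
        ((2 ^ n) ^ 2 - 2 ^ n) / 2 - (2 ^ n - 1) - (2 ^ n - 1),
        2 ^ n * 2 ^ n - ((2 ^ n) ^ 2 + 2 ^ n) / 2] i := by
  by_cases hn : Odd n
  · rw [eigenP_of_odd hn, if_pos hn, two_pow_of_odd hn]
    generalize ((2 ^ ((n - 1) / 2) : ℝ) : ℂ) = b
    fin_cases i <;> simp [oddP] <;> ring
  · rw [eigenP_of_even hn, if_neg hn, two_pow_of_even hn h0]
    generalize ((2 ^ ((n - 2) / 2) : ℝ) : ℂ) = b
    fin_cases i <;> simp [evenP] <;> ring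

theorem eigenP_row_one {i : Fin 6} (h0 : n ≠ 0) : eigenP n 1 i =
    if Odd n then ![1, 0 - 1, 0 - 1, 2 ^ n - 1, (0 ^ 2 - 2 ^ n) / 2 - (0 - 1),
        0 - (0 ^ 2 + 2 ^ n) / 2 - (0 - 1)] i
      else ![1, 0 - 1, 0 - 1, 2 ^ n - 1, (0 ^ 2 - 2 ^ n) / 2 - (0 - 1) - (0 - 1),
        0 - (0 ^ 2 + 2 ^ n) / 2] i := by
  by_cases hn : Odd n
  · rw [eigenP_of_odd hn, if_pos hn, two_pow_of_odd hn]
    generalize ((2 ^ ((n - 1) / 2) : ℝ) : ℂ) = b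
    fin_cases i <;> simp [oddP] <;> ring
  · rw [eigenP_of_even hn, if_neg hn, two_pow_of_even hn h0]
    generalize ((2 ^ ((n - 2) / 2) : ℝ) : ℂ) = b
    fin_cases i <;> simp [evenP] <;> ring

theorem IsPseudoPlanar.charSum_zero (hf : IsPseudoPlanar f) (hf0 : f 0 = 0) (i : Fin 6) :
    charSum 0 (schurClass f i) = eigenP n 0 i := by
  rw [eigenP_row_zero (degree_ne_zero h)]
  exact hf.charSum_schurClass hf0 0 pointSum_zero (by simp [map_ofNat])
    (sum_twoSqrt_of_trivial fun _ _ => rfl) sum_char_zero i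

theorem IsPseudoPlanar.charSum_of_trivial (hf : IsPseudoPlanar f) (hf0 : f 0 = 0)
    {χ : AddChar (GR4 h) ℂ} (h0 : χ ≠ 0) (hχ : ∀ z ∈ zeroDivs h, χ z = 1) (i : Fin 6) :
    charSum χ (schurClass f i) = eigenP n 1 i := by
  rw [eigenP_row_one (degree_ne_zero h)]
  exact hf.charSum_schurClass hf0 χ (pointSum_of_trivial h0 hχ) (map_zero _)
    (sum_twoSqrt_of_trivial hχ) (sum_char_eq_zero h0) i

/-- The characters that are nontrivial on `2R` give the last four rows of `P`, one for each Gaussian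
integer of norm `2 ^ n`. -/
theorem IsPseudoPlanar.charSum_of_not_trivial (hf : IsPseudoPlanar f) (hf0 : f 0 = 0)
    {χ : AddChar (GR4 h) ℂ} (hχ : ¬ ∀ z ∈ zeroDivs h, χ z = 1) :
    ∃ j : Fin 6, j ≠ 0 ∧ ∀ i, charSum χ (schurClass f i) = eigenP n j i := by
  have hI := Complex.I_sq
  have h0 : χ ≠ 0 := by
    rintro rfl
    exact hχ fun _ _ => rfl
  have key := fun d d' hd hd' => hf.charSum_schurClass (d := d) (d' := d') hf0 χ hd hd'
    (sum_twoSqrt_of_not_trivial hχ) (sum_char_eq_zero h0)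
  by_cases hn : Odd n
  · rw [eigenP_of_odd hn]
    have h1 := hf.pointSum_of_odd hn hχ (B := ((2 ^ ((n - 1) / 2) : ℝ) : ℂ)) (by push_cast; rfl)
    generalize (2 ^ ((n - 1) / 2) : ℝ) = β at h1 ⊢
    rcases h1 with hd | hd | hd | hd
    · refine ⟨2, by decide, fun i => ?_⟩
      rw [key _ (β - β * Complex.I) hd (by simp [sub_eq_add_neg]), if_pos hn]
      fin_cases i <;> simp [oddP] <;> grind
    · refine ⟨3, by decide, fun i => ?_⟩
      rw [key _ (β + β * Complex.I) hd (by simp), if_pos hn]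
      fin_cases i <;> simp [oddP] <;> grind
    · refine ⟨4, by decide, fun i => ?_⟩
      rw [key _ (-β - β * Complex.I) hd (by simp [sub_eq_add_neg]), if_pos hn]
      fin_cases i <;> simp [oddP] <;> grind
    · refine ⟨5, by decide, fun i => ?_⟩
      rw [key _ (-β + β * Complex.I) hd (by simp), if_pos hn]
      fin_cases i <;> simp [oddP] <;> grind
  · rw [eigenP_of_even hn]
    have h1 := hf.pointSum_of_even (Nat.not_odd_iff_even.1 hn) hχ
      (B := 2 * ((2 ^ ((n - 2) / 2) : ℝ) : ℂ)) (by
        have h0 := degree_ne_zero h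
        obtain ⟨m, rfl⟩ := Nat.not_odd_iff_even.1 hn
        push_cast
        rw [← pow_succ']
        congr 1
        omega)
    generalize (2 ^ ((n - 2) / 2) : ℝ) = β at h1 ⊢
    rcases h1 with hd | hd | hd | hd
    · refine ⟨2, by decide, fun i => ?_⟩
      rw [key _ (2 * β) hd (by simp [map_ofNat]), if_neg hn]
      fin_cases i <;> simp [evenP] <;> grind
    · refine ⟨3, by decide, fun i => ?_⟩
      rw [key _ (-(2 * β)) hd (by simp [map_ofNat]), if_neg hn]
      fin_cases i <;> simp [evenP] <;> grind
    · refine ⟨4, by decide, fun i => ?_⟩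
      rw [key _ (-(2 * β * Complex.I)) hd (by simp [map_ofNat]), if_neg hn]
      fin_cases i <;> simp [evenP] <;> grind
    · refine ⟨5, by decide, fun i => ?_⟩
      rw [key _ (2 * β * Complex.I) hd (by simp [map_ofNat]), if_neg hn]
      fin_cases i <;> simp [evenP] <;> grind

theorem IsPseudoPlanar.exists_mem_dualClass (hf : IsPseudoPlanar f) (hf0 : f 0 = 0)
    (χ : AddChar (GR4 h) ℂ) :
    ∃ j, χ ∈ dualClass f j ∧ ∀ i, charSum χ (schurClass f i) = eigenP n j i := by
  by_cases h0 : χ = 0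
  · subst h0
    exact ⟨0, by rw [dualClass_zero]; rfl, hf.charSum_zero hf0⟩
  · by_cases hχ : ∀ z ∈ zeroDivs h, χ z = 1
    · have h1 := hf.charSum_of_trivial hf0 h0 hχ
      exact ⟨1, (mem_dualClass_iff one_ne_zero χ).2 (h1 1), h1⟩
    · obtain ⟨j, hj, h1⟩ := hf.charSum_of_not_trivial hf0 hχ
      exact ⟨j, (mem_dualClass_iff hj χ).2 (h1 1), h1⟩

theorem IsPseudoPlanar.charSum_one_of_mem (hf : IsPseudoPlanar f) (hf0 : f 0 = 0)
    {χ : AddChar (GR4 h) ℂ} {j : Fin 6} (hχ : χ ∈ dualClass f j) :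
    charSum χ (schurClass f 1) = eigenP n j 1 := by
  by_cases hj : j = 0
  · subst hj
    rw [dualClass_zero] at hχ
    obtain rfl : χ = 0 := hχ
    exact hf.charSum_zero hf0 1
  · exact (mem_dualClass_iff hj χ).1 hχ

theorem IsPseudoPlanar.charSum_of_mem (hf : IsPseudoPlanar f) (hf0 : f 0 = 0)
    {χ : AddChar (GR4 h) ℂ} {j : Fin 6} (hχ : χ ∈ dualClass f j) (i : Fin 6) :
    charSum χ (schurClass f i) = eigenP n j i := by
  obtain ⟨k, -, hk⟩ := hf.exists_mem_dualClass hf0 χ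
  obtain rfl : j = k := eigenP_column_injective ((hf.charSum_one_of_mem hf0 hχ).symm.trans (hk 1))
  exact hk i

theorem IsPseudoPlanar.eq_iff_charSum_one (hf : IsPseudoPlanar f) (hf0 : f 0 = 0)
    {χ ψ : AddChar (GR4 h) ℂ} {i j : Fin 6} (hχ : χ ∈ dualClass f i) (hψ : ψ ∈ dualClass f j) :
    i = j ↔ charSum χ (schurClass f 1) = charSum ψ (schurClass f 1) := by
  rw [hf.charSum_one_of_mem hf0 hχ, hf.charSum_one_of_mem hf0 hψ]
  exact ⟨fun hij => hij ▸ rfl, eigenP_column_injective⟩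

theorem IsPseudoPlanar.dualClass_one (hf : IsPseudoPlanar f) (hf0 : f 0 = 0) :
    dualClass f 1 = {χ | χ ≠ 0 ∧ ∀ z ∈ zeroDivs h, χ z = 1} := by
  ext χ
  constructor
  · intro hχ
    have h1 : ∀ i, charSum χ (schurClass f i) = eigenP n 1 i := hf.charSum_of_mem hf0 hχ
    refine ⟨?_, ?_⟩
    · rintro rfl
      have h2 := eigenP_column_injective ((hf.charSum_zero hf0 1).symm.trans (h1 1))
      exact absurd h2 (by decide)
    · by_contra hne
      have h2 := h1 1
      rw [hf.charSum_one hf0, eigenP_row_one (degree_ne_zero h)] at h2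
      have h3 : pointSum f χ = 0 := by
        by_cases hn : Odd n <;> simpa [hn] using h2
      have h4 := hf.pointSum_mul_conj hne
      rw [h3, zero_mul] at h4
      exact pow_ne_zero n two_ne_zero h4.symm
  · rintro ⟨h0, hχ⟩
    exact (mem_dualClass_iff one_ne_zero χ).2 (hf.charSum_of_trivial hf0 h0 hχ 1)

/-- The classes `E j` are the fibres of a labelling of the characters by the rows of `P`, and `P` is
invertible with inverse `|R|⁻¹ Q`. -/
theorem IsPseudoPlanar.exists_label (hf : IsPseudoPlanar f) (hf0 : f 0 = 0) :
    ∃ ℓ : AddChar (GR4 h) ℂ → Fin 6, (∀ χ j, χ ∈ dualClass f j ↔ ℓ χ = j) ∧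
      HasEigenmatrix id ℓ (schurClass f) (eigenP n) (eigenQ n) (Fintype.card (GR4 h)) := by
  choose ℓ hℓ hval using hf.exists_mem_dualClass hf0
  refine ⟨ℓ, fun χ j => ⟨fun hχ => ?_, fun hj => hj ▸ hℓ χ⟩, isSeparating_id, hval, ?_, ?_,
    exists_mem_schurClass f, eq_of_mem_schurClass hf0⟩
  · exact eigenP_column_injective ((hval χ 1).symm.trans (hf.charSum_one_of_mem hf0 hχ))
  · exact Nat.cast_ne_zero.2 Fintype.card_ne_zero
  · rw [eigenP_mul_eigenQ (degree_ne_zero h), GR4.card]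
    push_cast
    rfl

theorem IsPseudoPlanar.schurClass_nonempty (hf : IsPseudoPlanar f) (hf0 : f 0 = 0) (h3 : 3 ≤ n)
    (i : Fin 6) : (schurClass f i).Nonempty := by
  rw [Set.nonempty_iff_ne_empty]
  intro he
  have h1 := hf.charSum_zero hf0 i
  rw [he, charSum] at h1
  refine eigenP_zero_ne_zero h3 i (h1.symm.trans ?_)
  simp

end Dual

theorem theorem3p4 {n : ℕ} (h : BasicIrreducible n) (f : Teich h → Teich h)
    (hf : IsPseudoPlanar f) (hf0 : f 0 = 0) :
    -- the sets `S₀, …, S₅` form a Schur ring over `R`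
    IsSchurRing 0 (schurClass f) ∧
    -- its dual is `E₀, …, E₅`
    IsDualSchurRing 0 (schurClass f) (dualClass f) ∧
    -- two characters lie in the same class `Eᵢ` iff they agree on `S₁`
    (∀ i j, ∀ χ ∈ dualClass f i, ∀ ψ ∈ dualClass f j,
      i = j ↔ charSum χ (schurClass f 1) = charSum ψ (schurClass f 1)) ∧
    -- `E₁` consists of the nonprincipal characters that are trivial on `Z`
    dualClass f 1 = {χ | χ ≠ 0 ∧ ∀ z ∈ zeroDivs h, χ z = 1} ∧
    -- for `n ≥ 3` the six classes form a `5`-class scheme with the stated eigenmatrices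
    (3 ≤ n →
      IsAssociationScheme (0 : Fin 6) (fun i => differenceRel (schurClass f i)) ∧
      (∃ e : Fin 6 → Matrix (GR4 h) (GR4 h) ℂ,
        IsIdempotentBasis (fun i => adjacency (differenceRel (schurClass f i))) e ∧
        IsFirstEigenmatrix (fun i => adjacency (differenceRel (schurClass f i))) e (eigenP n) ∧
        IsSecondEigenmatrix (fun i => adjacency (differenceRel (schurClass f i))) e (eigenQ n)) ∧
      ∀ j, ∀ χ ∈ dualClass f j, ∀ i, charSum χ (schurClass f i) = eigenP n j i) := by
  obtain ⟨ℓ, hℓ, H⟩ := hf.exists_label hf0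
  obtain ⟨σ, hσ⟩ := exists_conj_eigenP n
  obtain ⟨τ, hτ⟩ := exists_conj_eigenQ n
  choose m hm using exists_mem_schurClass f
  have hone := fun i j χ (hχ : χ ∈ dualClass f i) ψ (hψ : ψ ∈ dualClass f j) =>
    hf.eq_iff_charSum_one hf0 hχ hψ
  refine ⟨H.isSchurRing hσ rfl, ⟨?_, dualClass_zero f, ?_, ?_⟩, hone, hf.dualClass_one hf0, ?_⟩
  · exact Set.eq_univ_of_forall fun χ => Set.mem_iUnion.2 ⟨ℓ χ, (hℓ _ _).2 rfl⟩
  · intro i j χ hχ ψ hψ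
    refine ⟨?_, fun hk => (hone i j χ hχ ψ hψ).2 (hk 1)⟩
    rintro rfl k
    rw [hf.charSum_of_mem hf0 hχ, hf.charSum_of_mem hf0 hψ]
  · exact (H.dual hm hℓ).isSchurRing hτ (dualClass_zero f)
  · intro h3
    have hne := hf.schurClass_nonempty hf0 h3
    obtain ⟨hbasis, hfirst⟩ := H.isIdempotentBasis hne
    exact ⟨H.isAssociationScheme hσ id Function.injective_id hne (fun i _ => ⟨i, rfl⟩) 0 rfl,
      ⟨_, hbasis, hfirst, HasEigenmatrix.isSecondEigenmatrix _ _⟩,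
      fun j χ hχ i => hf.charSum_of_mem hf0 hχ i⟩
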